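/- Let $\omega=e^{2\pi i/3}$. (1) The map $$(x,y)\mapsto\left(\frac{4-x^3}{3x^2},\ \frac{i\sqrt3}{9}\,\frac{x^3+8}{x^3}\,y\right)$$ is a self-isogeny of degree $3$ of the complex elliptic curve $y^2=x^3-1$ (the affine points with $x=0$ being sent to the point at infinity $O$). (2) Let $\wp$ be the Weierstrass function of the lattice $\mathbb Z+\mathbb Z\omega$ and put $c=\dfrac{\wp(\omega/2)-\wp(1/2)}{\omega-1}$. Then $$\wp\big((1+2\omega)z\big)-\wp\left(\tfrac12\right)+c=\frac{4c^3-\left(\wp(z)-\wp\left(\tfrac12\right)+c\right)^3}{3\left(\wp(z)-\wp\left(\tfrac12\right)+c\right)^2}$$ for all $z\in\mathbb C$ with $(1+2\omega)z\notin\mathbb Z+\mathbb Z\omega$, the denominator on the right being nonzero for such $z$. (3) The map $$(x,y)\mapsto\left(\frac{(-1+2i)^2x\,(x^2-(1+2i))^2}{(5x^2-(1-2i))^2},\ \frac{(-1+2i)^3(x^2-(1+2i))(x^4+(8i+2)x^2+1)}{(5x^2-(1-2i))^3}\,y\right)$$ is a self-isogeny of degree $5$ of the complex elliptic curve $y^2=x^3-x$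 (the affine points with $5x^2=1-2i$ being sent to $O$). (4) Let $\wp$ be the Weierstrass function of the lattice $\mathbb Z+\mathbb Zi$. Then $$\wp\big((1+2i)z\big)=(-1+2i)^2\,\frac{\wp(z)\left(\wp(z)^2-(1+2i)\,\wp\left(\tfrac i2\right)^2\right)^2}{\left(5\wp(z)^2-(1-2i)\,\wp\left(\tfrac i2\right)^2\right)^2}$$ for all $z\in\mathbb C$ with $(1+2i)z\notin\mathbb Z+\mathbb Zi$, the denominator on the right being nonzero for such $z$. -/

import Mathlib

open scoped PeriodPair

noncomputable section

/-- The primitive cube root of unity `ω = e^{2πi/3}`. -/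
def cubeRoot : ℂ := Complex.exp (2 * Real.pi * Complex.I / 3)

theorem cubeRoot_im_ne_zero : cubeRoot.im ≠ 0 := by
  have h : (2 * Real.pi * Complex.I / 3 : ℂ) = ((2 * Real.pi / 3 : ℝ) : ℂ) * Complex.I := by
    push_cast; ring
  rw [cubeRoot, h, Complex.exp_ofReal_mul_I_im]
  refine (Real.sin_pos_of_pos_of_lt_pi ?_ ?_).ne'
  · positivity
  · linarith [Real.pi_pos]

theorem linearIndependent_one_of_im_ne_zero {τ : ℂ} (hτ : τ.im ≠ 0) :
    LinearIndependent ℝ ![(1 : ℂ), τ] := by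
  rw [LinearIndependent.pair_iff]
  intro s t h
  have him := congrArg Complex.im h
  have hre := congrArg Complex.re h
  simp [hτ] at him
  subst him
  simpa using hre

/-- The hexagonal lattice `ℤ + ℤω`. -/
def hexagonalPeriods : PeriodPair where
  ω₁ := 1
  ω₂ := cubeRoot
  indep := linearIndependent_one_of_im_ne_zero cubeRoot_im_ne_zero

/-- The square lattice `ℤ + ℤi`. -/
def squarePeriods : PeriodPair where
  ω₁ := 1
  ω₂ := Complex.I
  indep := linearIndependent_one_of_im_ne_zero (by simp)

/-- The elliptic curve `y² = x³ - 1` over `ℂ`. -/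
def hexagonalCurve : WeierstrassCurve.Affine ℂ where
  a₁ := 0
  a₂ := 0
  a₃ := 0
  a₄ := 0
  a₆ := -1

/-- The elliptic curve `y² = x³ - x` over `ℂ`. -/
def squareCurve : WeierstrassCurve.Affine ℂ where
  a₁ := 0
  a₂ := 0
  a₃ := 0
  a₄ := -1
  a₆ := 0

instance : WeierstrassCurve.IsElliptic hexagonalCurve where
  isUnit := by
    rw [isUnit_iff_ne_zero]
    norm_num [hexagonalCurve, WeierstrassCurve.Δ, WeierstrassCurve.b₂, WeierstrassCurve.b₄,
      WeierstrassCurve.b₆, WeierstrassCurve.b₈]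

instance : WeierstrassCurve.IsElliptic squareCurve where
  isUnit := by
    rw [isUnit_iff_ne_zero]
    norm_num [squareCurve, WeierstrassCurve.Δ, WeierstrassCurve.b₂, WeierstrassCurve.b₄,
      WeierstrassCurve.b₆, WeierstrassCurve.b₈]

namespace EllipticIsogeny

open WeierstrassCurve WeierstrassCurve.Affine Polynomial
open scoped Polynomial.Bivariate

/-- The class in the function field `ℂ(W)` of a polynomial in the coordinates `x` (inner variable)
and `y` (outer variable). -/
def toFunctionField (W : WeierstrassCurve.Affine ℂ) (p : ℂ[X][Y]) : W.FunctionField :=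
  algebraMap W.CoordinateRing W.FunctionField (CoordinateRing.mk W p)

/-- The coordinate function `x` in `ℂ(W)`. -/
def xFun (W : WeierstrassCurve.Affine ℂ) : W.FunctionField := toFunctionField W (C X)

/-- The coordinate function `y` in `ℂ(W)`. -/
def yFun (W : WeierstrassCurve.Affine ℂ) : W.FunctionField := toFunctionField W X

/-- The rational function `u ∈ ℂ(W)` is regular at the affine point `(a, b)` of `W` and takes the
value `c` there: `u = p / q` with `q(a, b) ≠ 0` and `p(a, b) / q(a, b) = c`. -/
def HasValueAt (W : WeierstrassCurve.Affine ℂ) (u : W.FunctionField) (a b c : ℂ) : Prop :=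
  ∃ p q : ℂ[X][Y], q.evalEval a b ≠ 0 ∧
    u * toFunctionField W q = toFunctionField W p ∧ p.evalEval a b = c * q.evalEval a b

/-- An isogeny `W → W'` of elliptic curves over `ℂ`: a homomorphism `f` of the groups of points
which is a nonconstant morphism of curves. The morphism is recorded through the induced embedding
`pullback : ℂ(W') → ℂ(W)` of function fields, and the conditions say that `f` is the map described
by the rational functions `pullback x` and `pullback y`. (The map `f` sends `O` to `O` since it is
a group homomorphism, and its agreement with the morphism at the affine points forces agreement
at `O`.) -/
structure IsIsogeny {W W' : WeierstrassCurve.Affine ℂ} [WeierstrassCurve.IsElliptic W]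
    [WeierstrassCurve.IsElliptic W'] (f : W.Point →+ W'.Point)
    (pullback : W'.FunctionField →ₐ[ℂ] W.FunctionField) : Prop where
  /-- At points mapped to an affine point `(c, d)`, the pullbacks of `x`, `y` take values
  `c`, `d`. -/
  value_of_eq_some : ∀ (a b : ℂ) (h : W.Nonsingular a b) (c d : ℂ) (h' : W'.Nonsingular c d),
    f (Point.some a b h) = Point.some c d h' →
      HasValueAt W (pullback (xFun W')) a b c ∧ HasValueAt W (pullback (yFun W')) a b d
  /-- At affine points mapped to `O`, the pullback of `x` has a pole. -/
  pole_of_eq_zero : ∀ (a b : ℂ) (h : W.Nonsingular a b),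
    f (Point.some a b h) = 0 → HasValueAt W (pullback (xFun W'))⁻¹ a b 0

/-- The degree of an isogeny `φ : W → W'` with the given pullback map, i.e. the degree of the field
extension `ℂ(W) / φ^* ℂ(W')`. -/
def isogenyDegree {W W' : WeierstrassCurve.Affine ℂ}
    (pullback : W'.FunctionField →ₐ[ℂ] W.FunctionField) : ℕ :=
  Module.finrank pullback.fieldRange W.FunctionField

/-- The map `f` on points is an isogeny `W → W'` of degree `n`. -/
def IsIsogenyOfDegree {W W' : WeierstrassCurve.Affine ℂ} [WeierstrassCurve.IsElliptic W]
    [WeierstrassCurve.IsElliptic W'] (f : W.Point →+ W'.Point) (n : ℕ) : Prop :=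
  ∃ pullback : W'.FunctionField →ₐ[ℂ] W.FunctionField,
    IsIsogeny f pullback ∧ isogenyDegree pullback = n

end EllipticIsogeny

end

/-!
Both maps of curves are endomorphisms coming from complex multiplication. The curve `y² = x³ - 1`
has the automorphism `[ω] : (x, y) ↦ (ωx, y)`, and the first map is `[ω] - [ω²] = [1 + 2ω]`; the
curve `y² = x³ - x` has the automorphism `[i] : (x, y) ↦ (-x, iy)`, and the second map is
`-[1 + 2i]`. As sums of automorphisms they are homomorphisms, and `hexagonalEnd_some`,
`squareEnd_some` find their formulas from the addition law.

A homomorphism given by a formula `(p(x)/q(x), r(x)/s(x) y)` is an isogeny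
(`isIsogenyOfDegree_of_formula`): the formula is a point of the curve over its own function field
`ℂ(W)`, since this amounts to a polynomial identity that may be checked at all complex values, and
the point defines the pullback `φ`. Both `ℂ(W)/ℂ(x)` and its image `φℂ(W)/ℂ(φx)` have the same
finite degree, so by multiplicativity the degree of `ℂ(W)/φℂ(W)` is that of `ℂ(x)/ℂ(φx)`, which is
the degree `max (deg p) (deg q)` of the rational function `p/q`
(`isogenyDegree_eq_max_natDegree`).

The identities for `℘` avoid the addition theorem. The function `u = 1/℘` is analytic at `0` with
`u(0) = 0`, and satisfies `u'² = Q(u)` with `Q(t) = 4t - g₂t³ - g₃t⁴`. Since `Q(0) = 0` the initial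
value problem is singular, but it has only one nonconstant analytic solution
(`eventuallyEq_of_deriv_sq_eq_eval`). With `g₂ = 0` for the hexagonal lattice and `g₃ = 0` for the
square one, both `1/℘(αz)` and the rational function `ρ(1/℘(z))` predicted by the identity solve
`v'² = α²Q(v)`, so they agree near `0` (`inv_weierstrassP_mul_eq`), and wherever both sides are
defined by the identity theorem. A zero of the denominator where `αz` is not a period would be a
zero of the numerator as well, which forces `℘` to vanish at the half period `1/2`, respectively
`i/2`. This is impossible because `℘` takes distinct values at half periods that differ modulo the
lattice (`weierstrassP_half_period_ne`), which follows from the same uniqueness theorem.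
-/

/-! ### Uniqueness for `u'² = Q(u)` at a root of `Q` -/

section

open Filter Topology

/-- A polynomial difference `Q(u) - Q(v)` is an analytic multiple of `u - v`. -/
theorem exists_analyticAt_eval_sub_eval (Q : Polynomial ℂ) {u v : ℂ → ℂ} {z₀ : ℂ}
    (hu : AnalyticAt ℂ u z₀) (hv : AnalyticAt ℂ v z₀) :
    ∃ g : ℂ → ℂ, AnalyticAt ℂ g z₀ ∧ ∀ z, Q.eval (u z) - Q.eval (v z) = (u z - v z) * g z := by
  induction Q using Polynomial.induction_on' with
  | add p q hp hq =>
    obtain ⟨g, hg, hg'⟩ := hp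
    obtain ⟨k, hk, hk'⟩ := hq
    refine ⟨g + k, hg.add hk, fun z ↦ ?_⟩
    simp only [Polynomial.eval_add, Pi.add_apply]
    linear_combination hg' z + hk' z
  | monomial n a =>
    refine ⟨fun z ↦ a * ∑ i ∈ Finset.range n, u z ^ i * v z ^ (n - 1 - i), ?_, fun z ↦ ?_⟩
    · have : AnalyticAt ℂ (fun z ↦ ∑ i ∈ Finset.range n, u z ^ i * v z ^ (n - 1 - i)) z₀ :=
        Finset.analyticAt_fun_sum _ fun i _ ↦ (hu.pow i).mul (hv.pow _)
      exact analyticAt_const.mul this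
    · have := (Commute.all (u z) (v z)).mul_geom_sum₂ n
      simp only [Polynomial.eval_monomial]
      linear_combination (-a) * this

/-- Differentiating `u'² = Q(u)` and cancelling `u'` gives `2u'' = Q'(u)`. -/
theorem two_mul_deriv_deriv_of_deriv_sq (Q : Polynomial ℂ) {u : ℂ → ℂ} {z₀ : ℂ}
    (hu : AnalyticAt ℂ u z₀) (hu' : ∀ᶠ z in 𝓝 z₀, deriv u z ^ 2 = Q.eval (u z))
    (hun : ¬ ∀ᶠ z in 𝓝 z₀, u z = u z₀) :
    ∀ᶠ z in 𝓝 z₀, 2 * deriv (deriv u) z = Q.derivative.eval (u z) := by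
  have hQ' : AnalyticAt ℂ (fun z ↦ Q.derivative.eval (u z)) z₀ := by
    simpa [Polynomial.aeval_def, Polynomial.eval₂_eq_eval_map] using
      (hu.aeval_polynomial Q.derivative)
  have key : ∀ᶠ z in 𝓝 z₀, deriv u z * (2 * deriv (deriv u) z) =
      deriv u z * Q.derivative.eval (u z) := by
    filter_upwards [(show (fun z ↦ deriv u z ^ 2) =ᶠ[𝓝 z₀] fun z ↦ Q.eval (u z) from
      hu').eventuallyEq_nhds, hu.eventually_analyticAt] with z hz haz
    have h1 : HasDerivAt (fun z ↦ deriv u z ^ 2) (2 * deriv u z * deriv (deriv u) z) z := by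
      simpa using haz.deriv.differentiableAt.hasDerivAt.fun_pow 2
    have h2 : HasDerivAt (fun z ↦ Q.eval (u z)) (Q.derivative.eval (u z) * deriv u z) z :=
      (Q.hasDerivAt (u z)).comp z haz.differentiableAt.hasDerivAt
    have := h1.unique (h2.congr_of_eventuallyEq hz)
    linear_combination this
  rcases hu.deriv.eventually_eq_zero_or_eventually_ne_zero with h0 | h0
  · refine absurd ?_ hun
    have h1 := hu.analyticOrderAt_deriv_add_one
    rw [analyticOrderAt_eq_top.2 h0, top_add, eq_comm, analyticOrderAt_eq_top] at h1
    simpa [sub_eq_zero] using h1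
  · refine (AnalyticAt.frequently_eq_iff_eventually_eq
      (analyticAt_const.mul hu.deriv.deriv) hQ').1 (Eventually.frequently ?_)
    filter_upwards [h0, key.filter_mono nhdsWithin_le_nhds] with z hz hz'
    exact mul_left_cancel₀ hz hz'

/-- Uniqueness for the singular initial value problem `u'² = Q(u)`, `u(z₀)` a root of `Q`, among
nonconstant analytic germs: the difference of two solutions vanishes to order at least `2` and
satisfies a second order equation, by which its order is at most that of its second derivative. -/
theorem eventuallyEq_of_deriv_sq_eq_eval (Q : Polynomial ℂ) {u v : ℂ → ℂ} {z₀ : ℂ}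
    (hu : AnalyticAt ℂ u z₀) (hv : AnalyticAt ℂ v z₀)
    (hu' : ∀ᶠ z in 𝓝 z₀, deriv u z ^ 2 = Q.eval (u z))
    (hv' : ∀ᶠ z in 𝓝 z₀, deriv v z ^ 2 = Q.eval (v z))
    (hun : ¬ ∀ᶠ z in 𝓝 z₀, u z = u z₀) (hvn : ¬ ∀ᶠ z in 𝓝 z₀, v z = v z₀)
    (huv : u z₀ = v z₀) (hQ : Q.eval (u z₀) = 0) :
    ∀ᶠ z in 𝓝 z₀, u z = v z := by
  have hu0 : deriv u z₀ = 0 := by simpa [hQ] using hu'.self_of_nhds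
  have hv0 : deriv v z₀ = 0 := by simpa [← huv, hQ] using hv'.self_of_nhds
  have hu2 := two_mul_deriv_deriv_of_deriv_sq Q hu hu' hun
  have hv2 := two_mul_deriv_deriv_of_deriv_sq Q hv hv' hvn
  obtain ⟨g, hg, hg'⟩ := exists_analyticAt_eval_sub_eval Q.derivative hu hv
  set d : ℂ → ℂ := fun z ↦ u z - v z with hd_def
  have hd : AnalyticAt ℂ d z₀ := hu.sub hv
  have hd1 : deriv d =ᶠ[𝓝 z₀] fun z ↦ deriv u z - deriv v z := by
    filter_upwards [hu.eventually_analyticAt, hv.eventually_analyticAt] with z h1 h2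
    exact deriv_fun_sub h1.differentiableAt h2.differentiableAt
  have hd2 : ∀ᶠ z in 𝓝 z₀, deriv (deriv d) z = d z * (g z / 2) := by
    filter_upwards [hd1.deriv, hu.deriv.eventually_analyticAt, hv.deriv.eventually_analyticAt,
      hu2, hv2] with z hz h1 h2 h3 h4
    rw [hz, deriv_fun_sub h1.differentiableAt h2.differentiableAt]
    linear_combination h3 / 2 - h4 / 2 + hg' z / 2
  have hd00 : d z₀ = 0 := by simp [d, huv]
  have hd10 : deriv d z₀ = 0 := by simp [hd1.self_of_nhds, hu0, hv0]
  have o1 := hd.analyticOrderAt_deriv_add_one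
  have o2 := hd.deriv.analyticOrderAt_deriv_add_one
  simp only [hd00, hd10, sub_zero] at o1 o2
  have o3 : analyticOrderAt d z₀ ≤ analyticOrderAt (deriv (deriv d)) z₀ := by
    rw [analyticOrderAt_congr hd2]
    change _ ≤ analyticOrderAt (d * fun z ↦ g z / 2) z₀
    rw [analyticOrderAt_mul hd (hg.div_const)]
    exact le_self_add
  have hfin : analyticOrderAt d z₀ = ⊤ := by
    by_contra hne
    rw [← o1, ← o2] at o3 hne
    generalize analyticOrderAt (deriv (deriv d)) z₀ = n at o3 hne
    cases n with
    | top => simp at hne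
    | coe n =>
      have : n + 1 + 1 ≤ n := by exact_mod_cast o3
      omega
  simpa [d, sub_eq_zero] using analyticOrderAt_eq_top.1 hfin

end

/-! ### The Weierstrass function near a lattice point and at half periods -/

noncomputable section

namespace PeriodPair

open Filter Topology Polynomial

variable (L : PeriodPair)

/-- A formula for `1/℘` which shows that it is analytic at `0`, with a double zero. It holds at
`z = 0` as well, where both sides are `0`. -/
theorem inv_weierstrassP_eq (z : ℂ) :
    (℘[L] z)⁻¹ = z ^ 2 * (z ^ 2 * L.weierstrassPExcept 0 z + 1)⁻¹ := by
  rcases eq_or_ne z 0 with rfl | hz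
  · simp
  · have h := L.ite_eq_one_sub_sq_mul_weierstrassP 0 L.lattice.zero_mem z
    simp only [hz, if_false, sub_zero] at h
    rw [zero_pow two_ne_zero, div_zero, sub_zero] at h
    rw [← h]
    field_simp

theorem analyticAt_inv_weierstrassP : AnalyticAt ℂ (fun z ↦ (℘[L] z)⁻¹) 0 := by
  simp only [inv_weierstrassP_eq]
  have h := L.analyticAt_weierstrassPExcept 0
  have h1 : AnalyticAt ℂ (fun z ↦ z ^ 2 * L.weierstrassPExcept 0 z + 1) 0 := by fun_prop
  exact (analyticAt_id.fun_pow 2).mul (h1.fun_inv (by simp))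

theorem eventually_weierstrassP_ne_zero : ∀ᶠ z in 𝓝[≠] (0 : ℂ), ℘[L] z ≠ 0 := by
  have h := L.analyticAt_weierstrassPExcept 0
  have h1 : AnalyticAt ℂ (fun z ↦ z ^ 2 * L.weierstrassPExcept 0 z + 1) 0 := by fun_prop
  filter_upwards [(h1.continuousAt.eventually_ne (y := 0) (by simp)).filter_mono
    nhdsWithin_le_nhds, self_mem_nhdsWithin] with z h2 hz h0
  have h3 := L.inv_weierstrassP_eq z
  rw [h0, inv_zero, eq_comm, mul_eq_zero, inv_eq_zero] at h3
  exact h3.elim (by simpa using hz) h2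

theorem not_eventually_inv_weierstrassP_eq_zero : ¬ ∀ᶠ z in 𝓝 (0 : ℂ), (℘[L] z)⁻¹ = 0 := by
  intro h
  obtain ⟨z, h1, h2⟩ :=
    ((h.filter_mono nhdsWithin_le_nhds).and L.eventually_weierstrassP_ne_zero).exists
  exact h2 (inv_eq_zero.1 h1)

theorem eventually_notMem_lattice (a : ℂ) : ∀ᶠ z in 𝓝[≠] a, z ∉ L.lattice := by
  filter_upwards [(L.compl_lattice_sdiff_singleton_mem_nhds a : _ ∈ 𝓝 a) |>
    mem_nhdsWithin_of_mem_nhds, self_mem_nhdsWithin] with z h1 h2 h3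
  exact h1 ⟨h3, h2⟩

theorem hasDerivAt_weierstrassP {z : ℂ} (hz : z ∉ L.lattice) :
    HasDerivAt ℘[L] (℘'[L] z) z := by
  simpa using (L.analyticOnNhd_weierstrassP z hz).differentiableAt.hasDerivAt

/-- The quartic `Q` with `u'² = Q(u)` for `u = 1/℘`. -/
def invCubic : ℂ[X] := 4 * X - C L.g₂ * X ^ 3 - C L.g₃ * X ^ 4

theorem eval_invCubic (t : ℂ) : L.invCubic.eval t = 4 * t - L.g₂ * t ^ 3 - L.g₃ * t ^ 4 := by
  simp [invCubic]

theorem deriv_inv_weierstrassP_sq :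
    ∀ᶠ z in 𝓝 (0 : ℂ), deriv (fun z ↦ (℘[L] z)⁻¹) z ^ 2 = L.invCubic.eval (℘[L] z)⁻¹ := by
  have hu := L.analyticAt_inv_weierstrassP
  have hQ : AnalyticAt ℂ (fun z ↦ L.invCubic.eval (℘[L] z)⁻¹) 0 := by
    simp only [eval_invCubic]
    fun_prop
  refine (AnalyticAt.frequently_eq_iff_eventually_eq (hu.deriv.fun_pow 2) hQ).1
    (Eventually.frequently ?_)
  filter_upwards [L.eventually_weierstrassP_ne_zero, L.eventually_notMem_lattice 0] with z h1 h2
  rw [((L.hasDerivAt_weierstrassP h2).fun_inv h1).deriv, eval_invCubic, div_pow, neg_sq,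
    L.derivWeierstrassP_sq z h2]
  field_simp

/-- If `ρ` is analytic at `0`, vanishes exactly there and intertwines the differential equation of
`1/℘` with that of `z ↦ 1/℘(αz)`, then `1/℘(αz) = ρ(1/℘(z))` near `0`. -/
theorem inv_weierstrassP_mul_eq (α : ℂ) (hα : α ≠ 0) {ρ : ℂ → ℂ} (hρ : AnalyticAt ℂ ρ 0)
    (hρ0 : ρ 0 = 0) (hρ1 : ∀ᶠ t in 𝓝[≠] 0, ρ t ≠ 0)
    (hρ2 : ∀ᶠ t in 𝓝 0, deriv ρ t ^ 2 * L.invCubic.eval t = α ^ 2 * L.invCubic.eval (ρ t)) :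
    ∀ᶠ z in 𝓝 (0 : ℂ), (℘[L] (α * z))⁻¹ = ρ (℘[L] z)⁻¹ := by
  have hu := L.analyticAt_inv_weierstrassP
  have hα0 : Tendsto (fun z ↦ α * z) (𝓝 0) (𝓝 0) := by
    simpa using (continuous_const_mul α).tendsto 0
  have hu0 : Tendsto (fun z ↦ (℘[L] z)⁻¹) (𝓝 0) (𝓝 0) := by
    simpa using hu.continuousAt.tendsto
  have hαu : AnalyticAt ℂ (fun z ↦ (℘[L] (α * z))⁻¹) 0 := by
    refine AnalyticAt.fun_comp (g := fun z ↦ (℘[L] z)⁻¹) (f := fun z ↦ α * z) ?_ (by fun_prop)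
    simpa using hu
  have hρu : AnalyticAt ℂ (fun z ↦ ρ (℘[L] z)⁻¹) 0 := by
    refine AnalyticAt.fun_comp (g := ρ) (f := fun z ↦ (℘[L] z)⁻¹) ?_ hu
    simpa using hρ
  refine eventuallyEq_of_deriv_sq_eq_eval (C (α ^ 2) * L.invCubic) hαu hρu ?_ ?_ ?_ ?_
    (by simp [hρ0]) (by simp [eval_invCubic])
  · filter_upwards [hα0.eventually L.deriv_inv_weierstrassP_sq] with z hz
    have h := deriv_comp_mul_left α (fun z ↦ (℘[L] z)⁻¹) z
    simp only [smul_eq_mul] at h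
    rw [h, mul_pow, hz, eval_mul, eval_C]
  · filter_upwards [L.deriv_inv_weierstrassP_sq, hu.eventually_analyticAt,
      hu0.eventually hρ.eventually_analyticAt, hu0.eventually hρ2] with z h1 h2 h3 h4
    have h : deriv (fun z ↦ ρ (℘[L] z)⁻¹) z
        = deriv ρ (℘[L] z)⁻¹ * deriv (fun z ↦ (℘[L] z)⁻¹) z :=
      (HasDerivAt.comp z h3.differentiableAt.hasDerivAt h2.differentiableAt.hasDerivAt).deriv
    rw [h, mul_pow, h1, h4, eval_mul, eval_C]
  · simp only [mul_zero, weierstrassP_zero, inv_zero]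
    intro h
    refine L.not_eventually_inv_weierstrassP_eq_zero ?_
    have hα1 : Tendsto (fun z ↦ α⁻¹ * z) (𝓝 0) (𝓝 0) := by
      simpa using (continuous_const_mul α⁻¹).tendsto 0
    filter_upwards [hα1.eventually h] with z hz
    simpa [hα] using hz
  · simp only [weierstrassP_zero, inv_zero, hρ0]
    intro h
    have hu1 : Tendsto (fun z ↦ (℘[L] z)⁻¹) (𝓝[≠] 0) (𝓝[≠] 0) := by
      refine tendsto_nhdsWithin_iff.2 ⟨hu0.mono_left nhdsWithin_le_nhds, ?_⟩
      filter_upwards [L.eventually_weierstrassP_ne_zero] with z hz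
      simpa using hz
    obtain ⟨z, h1, h2⟩ :=
      ((h.filter_mono nhdsWithin_le_nhds).and (hu1.eventually hρ1)).exists
    exact h2 h1

/-- The identity theorem for meromorphic functions on `ℂ`. -/
theorem eventually_eq_zero_of_meromorphic {F : ℂ → ℂ} (hF : Meromorphic F) {a : ℂ}
    (ha : ∀ᶠ z in 𝓝[≠] a, F z = 0) (b : ℂ) : ∀ᶠ z in 𝓝[≠] b, F z = 0 := by
  rw [← meromorphicOrderAt_eq_top_iff] at ha ⊢
  by_contra hb
  exact hF.exists_meromorphicOrderAt_ne_top_iff_forall.1 ⟨b, hb⟩ a ha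

theorem meromorphic_weierstrassP_add (a : ℂ) : Meromorphic fun z ↦ ℘[L] (z + a) := fun x ↦
  MeromorphicAt.comp_analyticAt (f := ℘[L]) (g := fun z ↦ z + a) (L.meromorphic_weierstrassP _)
    (by fun_prop)

theorem meromorphic_weierstrassP_mul (α : ℂ) : Meromorphic fun z ↦ ℘[L] (α * z) := fun x ↦
  MeromorphicAt.comp_analyticAt (f := ℘[L]) (g := fun z ↦ α * z) (L.meromorphic_weierstrassP _)
    (by fun_prop)

/-- Two translates of `℘` that agree near a point differ by a period. -/
theorem sub_mem_lattice_of_eventually_eq {a b c : ℂ}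
    (h : ∀ᶠ z in 𝓝[≠] c, ℘[L] (z + a) = ℘[L] (z + b)) : a - b ∈ L.lattice := by
  by_contra hab
  have h1 := eventually_eq_zero_of_meromorphic
    ((L.meromorphic_weierstrassP_add a).fun_sub (L.meromorphic_weierstrassP_add b))
    (h.mono fun z hz ↦ sub_eq_zero.2 hz) (-b)
  -- near `-b` the function `℘(z + a)` is bounded, while `1/℘(z + b)` tends to `0`
  have h2 : ContinuousAt (fun z ↦ ℘[L] (z + a)) (-b) := by
    refine ContinuousAt.comp' (g := ℘[L]) ?_ (by fun_prop)
    rw [neg_add_eq_sub]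
    exact (L.analyticOnNhd_weierstrassP _ hab).continuousAt
  have h3 : ContinuousAt (fun z ↦ (℘[L] (z + b))⁻¹) (-b) := by
    refine ContinuousAt.comp' (g := fun z ↦ (℘[L] z)⁻¹) ?_ (by fun_prop)
    rw [neg_add_cancel]
    exact L.analyticAt_inv_weierstrassP.continuousAt
  have h4 : Tendsto (fun z ↦ ℘[L] (z + a) * (℘[L] (z + b))⁻¹) (𝓝[≠] (-b)) (𝓝 0) := by
    simpa using ((h2.fun_mul h3).tendsto.mono_left nhdsWithin_le_nhds)
  have h5 : Tendsto (fun z ↦ z + b) (𝓝[≠] (-b)) (𝓝[≠] 0) := by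
    refine tendsto_nhdsWithin_iff.2 ⟨?_, ?_⟩
    · simpa using ((continuous_add_const b).tendsto (-b)).mono_left nhdsWithin_le_nhds
    · filter_upwards [self_mem_nhdsWithin] with z hz
      simpa [add_eq_zero_iff_eq_neg] using hz
  have h6 : (fun z ↦ ℘[L] (z + a) * (℘[L] (z + b))⁻¹) =ᶠ[𝓝[≠] (-b)] fun _ ↦ 1 := by
    filter_upwards [h1, h5.eventually L.eventually_weierstrassP_ne_zero] with z h7 h8
    rw [sub_eq_zero.1 h7, mul_inv_cancel₀ h8]
  exact zero_ne_one (tendsto_nhds_unique (h4.congr' h6) tendsto_const_nhds)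

theorem not_eventually_weierstrassP_add_eq (a : ℂ) :
    ¬ ∀ᶠ z in 𝓝 (0 : ℂ), ℘[L] (z + a) = ℘[L] (0 + a) := by
  intro h
  refine L.ω₁_div_two_notMem_lattice ?_
  have h1 := eventually_eq_zero_of_meromorphic
    ((L.meromorphic_weierstrassP_add a).fun_sub (Meromorphic.const (℘[L] (0 + a))))
    ((h.filter_mono nhdsWithin_le_nhds).mono fun z hz ↦ sub_eq_zero.2 hz)
  have h2 : Tendsto (fun z ↦ z + L.ω₁ / 2) (𝓝[≠] 0) (𝓝[≠] (L.ω₁ / 2)) := by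
    refine tendsto_nhdsWithin_iff.2 ⟨?_, ?_⟩
    · simpa using ((continuous_add_const (L.ω₁ / 2)).tendsto 0).mono_left nhdsWithin_le_nhds
    · filter_upwards [self_mem_nhdsWithin] with z hz
      simpa using hz
  have := L.sub_mem_lattice_of_eventually_eq (a := L.ω₁ / 2 + a) (b := a) (c := 0) (by
    filter_upwards [h1 0, h2.eventually (h1 (L.ω₁ / 2))] with z h3 h4
    rw [sub_eq_zero.1 h3, ← sub_eq_zero.1 h4, add_assoc])
  simpa using this

theorem derivWeierstrassP_eq_zero_of_two_mul_mem {a : ℂ} (h : 2 * a ∈ L.lattice) :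
    ℘'[L] a = 0 := by
  have h1 := L.derivWeierstrassP_sub_coe a ⟨2 * a, h⟩
  rw [show a - (2 * a : ℂ) = -a by ring, derivWeierstrassP_neg] at h1
  linear_combination (-1 / 2) * h1

/-- The values of `℘` at half periods are roots of the cubic `4X³ - g₂X - g₃`. -/
theorem cubic_weierstrassP_eq_zero {a : ℂ} (ha : a ∉ L.lattice) (h : 2 * a ∈ L.lattice) :
    4 * ℘[L] a ^ 3 - L.g₂ * ℘[L] a - L.g₃ = 0 := by
  rw [← L.derivWeierstrassP_sq a ha, L.derivWeierstrassP_eq_zero_of_two_mul_mem h]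
  ring

/-- `℘` takes the value `℘(a)` at a half period `a` only at `a` modulo the lattice: the
translates of `℘` by two points with this value would solve the same singular initial value problem. -/
theorem weierstrassP_half_period_ne {a b : ℂ} (ha : a ∉ L.lattice) (hb : b ∉ L.lattice)
    (ha2 : 2 * a ∈ L.lattice) (hab : a - b ∉ L.lattice) :
    ℘[L] a ≠ ℘[L] b := by
  intro heq
  have han (c : ℂ) (hc : c ∉ L.lattice) : AnalyticAt ℂ (fun z ↦ ℘[L] (z + c)) 0 := by
    refine AnalyticAt.fun_comp (g := ℘[L]) ?_ (by fun_prop)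
    simpa using L.analyticOnNhd_weierstrassP c hc
  have hode (c : ℂ) (hc : c ∉ L.lattice) : ∀ᶠ z in 𝓝 (0 : ℂ),
      deriv (fun z ↦ ℘[L] (z + c)) z ^ 2 =
        (4 * X ^ 3 - C L.g₂ * X - C L.g₃ : ℂ[X]).eval (℘[L] (z + c)) := by
    have hopen : ∀ᶠ z in 𝓝 (0 : ℂ), z + c ∉ L.lattice := by
      have : (L.lattice : Set ℂ)ᶜ ∈ 𝓝 (0 + c) := by
        rw [zero_add]
        exact L.isClosed_lattice.isOpen_compl.mem_nhds hc
      exact (continuous_add_const c).continuousAt this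
    filter_upwards [hopen] with z hz
    rw [deriv_comp_add_const, deriv_weierstrassP, L.derivWeierstrassP_sq _ hz]
    simp
  have h := eventuallyEq_of_deriv_sq_eq_eval _ (han a ha) (han b hb) (hode a ha) (hode b hb)
    (L.not_eventually_weierstrassP_add_eq a) (L.not_eventually_weierstrassP_add_eq b)
    (by simpa using heq) (by simpa using L.cubic_weierstrassP_eq_zero ha ha2)
  exact hab (L.sub_mem_lattice_of_eventually_eq (h.filter_mono nhdsWithin_le_nhds))

/-- Multiplication by a complex number that preserves the lattice. -/
def latticeMulEquiv {ε : ℂ} (hε : ε ≠ 0) (h : ∀ l ∈ L.lattice, ε * l ∈ L.lattice)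
    (h' : ∀ l ∈ L.lattice, ε⁻¹ * l ∈ L.lattice) : L.lattice ≃ L.lattice where
  toFun l := ⟨ε * l, h l l.2⟩
  invFun l := ⟨ε⁻¹ * l, h' l l.2⟩
  left_inv l := by ext; simp [hε]
  right_inv l := by ext; simp [hε]

theorem weierstrassP_automorphism {ε : ℂ} (hε : ε ≠ 0) (h : ∀ l ∈ L.lattice, ε * l ∈ L.lattice)
    (h' : ∀ l ∈ L.lattice, ε⁻¹ * l ∈ L.lattice) (z : ℂ) :
    ℘[L] (ε * z) = (ε ^ 2)⁻¹ * ℘[L] z := by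
  simp only [weierstrassP]
  rw [← (L.latticeMulEquiv hε h h').tsum_eq, ← tsum_mul_left]
  congr! 2 with l
  simp only [latticeMulEquiv, Equiv.coe_fn_mk, ← mul_sub, mul_pow, one_div, mul_inv]

theorem G_automorphism {ε : ℂ} (hε : ε ≠ 0) (h : ∀ l ∈ L.lattice, ε * l ∈ L.lattice)
    (h' : ∀ l ∈ L.lattice, ε⁻¹ * l ∈ L.lattice) (n : ℕ) :
    L.G n = (ε ^ n)⁻¹ * L.G n := by
  conv_lhs => rw [G, ← (L.latticeMulEquiv hε h h').tsum_eq]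
  rw [G, ← tsum_mul_left]
  congr! 2 with l
  simp only [latticeMulEquiv, Equiv.coe_fn_mk, mul_pow, mul_inv]

end PeriodPair

end

/-! ### Complex multiplication on the hexagonal and the square lattice -/

section

open Filter Topology

theorem cubeRoot_sq_add_cubeRoot_add_one : cubeRoot ^ 2 + cubeRoot + 1 = 0 := by
  have h : IsPrimitiveRoot cubeRoot 3 := Complex.isPrimitiveRoot_exp 3 (by norm_num)
  have := h.geom_sum_eq_zero (by norm_num)
  simp only [Finset.sum_range_succ, Finset.sum_range_zero] at this
  linear_combination this

theorem cubeRoot_ne_zero : cubeRoot ≠ 0 := Complex.exp_ne_zero _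

theorem cubeRoot_sub_one_ne_zero : cubeRoot - 1 ≠ 0 := by
  intro h
  have := cubeRoot_sq_add_cubeRoot_add_one
  rw [sub_eq_zero.1 h] at this
  norm_num at this

theorem cubeRoot_pow_three : cubeRoot ^ 3 = 1 := by
  linear_combination (cubeRoot - 1) * cubeRoot_sq_add_cubeRoot_add_one

theorem one_add_two_mul_cubeRoot_sq : (1 + 2 * cubeRoot) ^ 2 = -3 := by
  linear_combination 4 * cubeRoot_sq_add_cubeRoot_add_one

theorem mem_hexagonalPeriods_lattice {z : ℂ} :
    z ∈ hexagonalPeriods.lattice ↔ ∃ m n : ℤ, m + n * cubeRoot = z := by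
  simp [PeriodPair.mem_lattice, hexagonalPeriods]

theorem mem_squarePeriods_lattice {z : ℂ} :
    z ∈ squarePeriods.lattice ↔ ∃ m n : ℤ, m + n * Complex.I = z := by
  simp [PeriodPair.mem_lattice, squarePeriods]

theorem cubeRoot_mul_mem {l : ℂ} (hl : l ∈ hexagonalPeriods.lattice) :
    cubeRoot * l ∈ hexagonalPeriods.lattice := by
  rw [mem_hexagonalPeriods_lattice] at *
  obtain ⟨m, n, rfl⟩ := hl
  refine ⟨-n, m - n, ?_⟩
  push_cast
  linear_combination (-n : ℂ) * cubeRoot_sq_add_cubeRoot_add_one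

theorem cubeRoot_inv_mul_mem {l : ℂ} (hl : l ∈ hexagonalPeriods.lattice) :
    cubeRoot⁻¹ * l ∈ hexagonalPeriods.lattice := by
  have : cubeRoot⁻¹ = cubeRoot * cubeRoot := by
    refine inv_eq_of_mul_eq_one_right ?_
    linear_combination cubeRoot_pow_three
  rw [this, mul_assoc]
  exact cubeRoot_mul_mem (cubeRoot_mul_mem hl)

theorem I_mul_mem {l : ℂ} (hl : l ∈ squarePeriods.lattice) :
    Complex.I * l ∈ squarePeriods.lattice := by
  rw [mem_squarePeriods_lattice] at *
  obtain ⟨m, n, rfl⟩ := hl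
  refine ⟨-n, m, ?_⟩
  push_cast
  linear_combination (-n : ℂ) * Complex.I_sq

theorem I_inv_mul_mem {l : ℂ} (hl : l ∈ squarePeriods.lattice) :
    Complex.I⁻¹ * l ∈ squarePeriods.lattice := by
  rw [Complex.inv_I, neg_mul]
  exact neg_mem (I_mul_mem hl)

theorem weierstrassP_cubeRoot_mul (z : ℂ) :
    ℘[hexagonalPeriods] (cubeRoot * z) = cubeRoot * ℘[hexagonalPeriods] z := by
  rw [hexagonalPeriods.weierstrassP_automorphism cubeRoot_ne_zero (fun _ ↦ cubeRoot_mul_mem)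
    fun _ ↦ cubeRoot_inv_mul_mem]
  congr 1
  refine inv_eq_of_mul_eq_one_right ?_
  linear_combination cubeRoot_pow_three

theorem hexagonalPeriods_g₂ : hexagonalPeriods.g₂ = 0 := by
  have h := hexagonalPeriods.G_automorphism cubeRoot_ne_zero (fun _ ↦ cubeRoot_mul_mem)
    (fun _ ↦ cubeRoot_inv_mul_mem) 4
  rw [show cubeRoot ^ 4 = cubeRoot by linear_combination cubeRoot * cubeRoot_pow_three,
    eq_inv_mul_iff_mul_eq₀ cubeRoot_ne_zero] at h
  have h1 : (cubeRoot - 1) * hexagonalPeriods.G 4 = 0 := by linear_combination h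
  rw [PeriodPair.g₂, (mul_eq_zero.1 h1).resolve_left cubeRoot_sub_one_ne_zero, mul_zero]

theorem weierstrassP_I_mul (z : ℂ) :
    ℘[squarePeriods] (Complex.I * z) = -℘[squarePeriods] z := by
  rw [squarePeriods.weierstrassP_automorphism Complex.I_ne_zero (fun _ ↦ I_mul_mem)
    fun _ ↦ I_inv_mul_mem, Complex.I_sq]
  norm_num

theorem squarePeriods_g₃ : squarePeriods.g₃ = 0 := by
  have h := squarePeriods.G_automorphism Complex.I_ne_zero (fun _ ↦ I_mul_mem)
    (fun _ ↦ I_inv_mul_mem) 6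
  rw [show Complex.I ^ 6 = -1 by rw [Complex.I_pow_eq_pow_mod]; norm_num] at h
  have h1 : squarePeriods.G 6 = 0 := by linear_combination h / 2
  rw [PeriodPair.g₃, h1, mul_zero]

theorem half_notMem_hexagonal : (1 / 2 : ℂ) ∉ hexagonalPeriods.lattice :=
  hexagonalPeriods.ω₁_div_two_notMem_lattice

theorem half_cubeRoot_notMem_hexagonal : cubeRoot / 2 ∉ hexagonalPeriods.lattice :=
  hexagonalPeriods.ω₂_div_two_notMem_lattice

theorem half_I_notMem_square : Complex.I / 2 ∉ squarePeriods.lattice :=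
  squarePeriods.ω₂_div_two_notMem_lattice

theorem PeriodPair.half_ω₁_add_ω₂_notMem (L : PeriodPair) :
    (L.ω₁ + L.ω₂) / 2 ∉ L.lattice := by
  have := (L.mul_ω₁_add_mul_ω₂_mem_lattice (α := 1 / 2) (β := 1 / 2)).not.mpr (by norm_num)
  convert this using 1
  push_cast
  ring_nf

/-- Otherwise `℘` would vanish at `1/2` and, by its symmetry, at `ω/2`, half periods that differ
modulo the lattice. -/
theorem weierstrassP_half_hexagonal_ne_zero : ℘[hexagonalPeriods] (1 / 2) ≠ 0 := by
  intro h0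
  refine hexagonalPeriods.weierstrassP_half_period_ne half_notMem_hexagonal
    half_cubeRoot_notMem_hexagonal ?_ ?_ ?_
  · exact mem_hexagonalPeriods_lattice.2 ⟨1, 0, by simp⟩
  · intro h
    refine hexagonalPeriods.half_ω₁_add_ω₂_notMem ?_
    have h1 := add_mem h hexagonalPeriods.ω₂_mem_lattice
    convert h1 using 1
    simp only [hexagonalPeriods]
    ring
  · rw [show cubeRoot / 2 = cubeRoot * (1 / 2) by ring, weierstrassP_cubeRoot_mul, h0, mul_zero]

/-- At `(1 + i)/2`, which is fixed by multiplication by `i` modulo the lattice, `℘` vanishes, so it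
cannot vanish at `i/2`, a half period that differs from `(1 + i)/2` modulo the lattice. -/
theorem weierstrassP_half_I_ne_zero : ℘[squarePeriods] (Complex.I / 2) ≠ 0 := by
  intro h0
  have h1 : ℘[squarePeriods] ((1 + Complex.I) / 2) = 0 := by
    have h2 := weierstrassP_I_mul ((1 + Complex.I) / 2)
    have h3 := squarePeriods.weierstrassP_sub_coe ((1 + Complex.I) / 2)
      ⟨1, squarePeriods.ω₁_mem_lattice⟩
    rw [show Complex.I * ((1 + Complex.I) / 2) = (1 + Complex.I) / 2 - 1 by
      linear_combination Complex.I_sq / 2] at h2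
    simp only at h3
    linear_combination h2 / 2 - h3 / 2
  refine squarePeriods.weierstrassP_half_period_ne half_I_notMem_square
    squarePeriods.half_ω₁_add_ω₂_notMem ?_ ?_ (h0.trans h1.symm)
  · exact mem_squarePeriods_lattice.2 ⟨0, 1, by push_cast; ring⟩
  · intro h
    refine squarePeriods.ω₁_div_two_notMem_lattice ?_
    convert neg_mem h using 1
    simp only [squarePeriods]
    ring

/-- An identity between `℘(αz)` and `℘(z)` near `0` persists wherever `αz` is not a period. -/
theorem PeriodPair.eq_zero_of_eventually_eq_zero (L : PeriodPair) {α : ℂ} (P : ℂ → ℂ → ℂ)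
    (hmul : ∀ l ∈ L.lattice, α * l ∈ L.lattice)
    (hmer : Meromorphic fun z ↦ P (℘[L] (α * z)) (℘[L] z))
    (hcont : Continuous fun p : ℂ × ℂ ↦ P p.1 p.2)
    (h0 : ∀ᶠ z in 𝓝[≠] 0, P (℘[L] (α * z)) (℘[L] z) = 0) {z : ℂ} (hz : α * z ∉ L.lattice) :
    P (℘[L] (α * z)) (℘[L] z) = 0 := by
  have h1 := eventually_eq_zero_of_meromorphic hmer h0 z
  have hz' : z ∉ L.lattice := fun h ↦ hz (hmul z h)
  have h2 : ContinuousAt (fun z ↦ ℘[L] (α * z)) z :=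
    ContinuousAt.comp' (g := ℘[L]) (L.analyticOnNhd_weierstrassP _ hz).continuousAt (by fun_prop)
  have h3 : ContinuousAt (fun z ↦ P (℘[L] (α * z)) (℘[L] z)) z :=
    ContinuousAt.comp' (g := fun p : ℂ × ℂ ↦ P p.1 p.2) hcont.continuousAt
      (h2.prodMk (L.analyticOnNhd_weierstrassP _ hz').continuousAt)
  exact tendsto_nhds_unique (h3.tendsto.mono_left nhdsWithin_le_nhds)
    (tendsto_const_nhds.congr' (h1.mono fun _ h ↦ h.symm))

/-- The transformation of `℘` under `z ↦ (1 + 2ω)z`, free of denominators. -/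
theorem weierstrassP_hexagonal_mul {z : ℂ}
    (hz : (1 + 2 * cubeRoot) * z ∉ hexagonalPeriods.lattice) :
    ℘[hexagonalPeriods] ((1 + 2 * cubeRoot) * z) * (3 * ℘[hexagonalPeriods] z ^ 2)
      - (4 * ℘[hexagonalPeriods] (1 / 2) ^ 3 - ℘[hexagonalPeriods] z ^ 3) = 0 := by
  set α := 1 + 2 * cubeRoot with hα
  set k := ℘[hexagonalPeriods] (1 / 2) ^ 3 with hk
  have hα2 : α ^ 2 = -3 := one_add_two_mul_cubeRoot_sq
  have hα0 : α ≠ 0 := by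
    intro h
    norm_num [h] at hα2
  have hg₃ : hexagonalPeriods.g₃ = 4 * k := by
    have := hexagonalPeriods.cubic_weierstrassP_eq_zero half_notMem_hexagonal
      (mem_hexagonalPeriods_lattice.2 ⟨1, 0, by simp⟩)
    rw [hexagonalPeriods_g₂] at this
    linear_combination -this
  have hmul : ∀ l ∈ hexagonalPeriods.lattice, α * l ∈ hexagonalPeriods.lattice := fun l hl ↦ by
    have h := add_mem hl (add_mem (cubeRoot_mul_mem hl) (cubeRoot_mul_mem hl))
    convert h using 1
    rw [hα]
    ring
  -- `ρ(t) = 1/R(1/t)` where `R(x) = (4k - x³)/(3x²)`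
  have hden : ∀ᶠ t in 𝓝 (0 : ℂ), 4 * k * t ^ 3 - 1 ≠ 0 :=
    (by fun_prop : ContinuousAt (fun t : ℂ ↦ 4 * k * t ^ 3 - 1) 0).eventually_ne (by norm_num)
  have key := hexagonalPeriods.inv_weierstrassP_mul_eq α hα0
    (ρ := fun t ↦ 3 * t / (4 * k * t ^ 3 - 1)) ?_ (by simp) ?_ ?_
  · refine hexagonalPeriods.eq_zero_of_eventually_eq_zero
      (fun w x ↦ w * (3 * x ^ 2) - (4 * k - x ^ 3)) hmul ?_ (by fun_prop) ?_ hz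
    · have h1 := hexagonalPeriods.meromorphic_weierstrassP_mul α
      have h2 := hexagonalPeriods.meromorphic_weierstrassP
      fun_prop
    · filter_upwards [key.filter_mono nhdsWithin_le_nhds,
        hexagonalPeriods.eventually_weierstrassP_ne_zero] with z h1 h2
      rw [← inv_inv (℘[hexagonalPeriods] (α * z)), h1, inv_div]
      field_simp
      ring
  · exact AnalyticAt.fun_div (by fun_prop) (by fun_prop) (by norm_num)
  · filter_upwards [self_mem_nhdsWithin, hden.filter_mono nhdsWithin_le_nhds] with t h1 h2
    exact div_ne_zero (mul_ne_zero three_ne_zero h1) h2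
  · filter_upwards [hden] with t ht
    have h1 : HasDerivAt (fun t : ℂ ↦ 3 * t) 3 t := by
      simpa using (hasDerivAt_id t).const_mul 3
    have h2 : HasDerivAt (fun t : ℂ ↦ 4 * k * t ^ 3 - 1) (4 * k * (3 * t ^ 2)) t := by
      simpa using ((hasDerivAt_pow 3 t).const_mul (4 * k)).sub_const 1
    rw [(h1.fun_div h2 ht).deriv]
    simp only [PeriodPair.eval_invCubic, hexagonalPeriods_g₂, hg₃, hα2]
    field_simp
    ring

/-- The transformation of `℘` under `z ↦ (1 + 2i)z`, free of denominators. -/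
theorem weierstrassP_square_mul {z : ℂ} (hz : (1 + 2 * Complex.I) * z ∉ squarePeriods.lattice) :
    ℘[squarePeriods] ((1 + 2 * Complex.I) * z) * (5 * ℘[squarePeriods] z ^ 2
        - (1 - 2 * Complex.I) * ℘[squarePeriods] (Complex.I / 2) ^ 2) ^ 2
      - (-1 + 2 * Complex.I) ^ 2 * (℘[squarePeriods] z * (℘[squarePeriods] z ^ 2
        - (1 + 2 * Complex.I) * ℘[squarePeriods] (Complex.I / 2) ^ 2) ^ 2) = 0 := by
  set k := ℘[squarePeriods] (Complex.I / 2) ^ 2 with hk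
  set α := 1 + 2 * Complex.I with hα
  have hα2 : α ^ 2 = 2 * α - 5 := by
    rw [hα]
    linear_combination 4 * Complex.I_sq
  have hα0 : α ≠ 0 := by
    intro h
    norm_num [h] at hα2
  rw [show 1 - 2 * Complex.I = 2 - α by rw [hα]; ring,
    show -1 + 2 * Complex.I = α - 2 by rw [hα]; ring]
  have hg₂ : squarePeriods.g₂ = 4 * k := by
    have := squarePeriods.cubic_weierstrassP_eq_zero half_I_notMem_square
      (mem_squarePeriods_lattice.2 ⟨0, 1, by push_cast; ring⟩)
    rw [squarePeriods_g₃] at this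
    refine mul_right_cancel₀ weierstrassP_half_I_ne_zero ?_
    linear_combination -this
  have hmul : ∀ l ∈ squarePeriods.lattice, α * l ∈ squarePeriods.lattice := fun l hl ↦ by
    have h := add_mem hl (add_mem (I_mul_mem hl) (I_mul_mem hl))
    convert h using 1
    rw [hα]
    ring
  -- `ρ(t) = 1/R(1/t)` where `R(x) = (α - 2)²x(x² - αk)²/(5x² - (2 - α)k)²`
  have hden : ∀ᶠ t in 𝓝 (0 : ℂ), 1 - α * k * t ^ 2 ≠ 0 :=
    (by fun_prop : ContinuousAt (fun t : ℂ ↦ 1 - α * k * t ^ 2) 0).eventually_ne (by norm_num)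
  have hnum : ∀ᶠ t in 𝓝 (0 : ℂ), α - k * t ^ 2 ≠ 0 :=
    (by fun_prop : ContinuousAt (fun t : ℂ ↦ α - k * t ^ 2) 0).eventually_ne (by simpa using hα0)
  have key := squarePeriods.inv_weierstrassP_mul_eq α hα0
    (ρ := fun t ↦ t * (α - k * t ^ 2) ^ 2 / (1 - α * k * t ^ 2) ^ 2) ?_ (by simp) ?_ ?_
  · refine squarePeriods.eq_zero_of_eventually_eq_zero
      (fun w x ↦ w * (5 * x ^ 2 - (2 - α) * k) ^ 2 - (α - 2) ^ 2 * (x * (x ^ 2 - α * k) ^ 2))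
      hmul ?_ (by fun_prop) ?_ hz
    · have h1 := squarePeriods.meromorphic_weierstrassP_mul α
      have h2 := squarePeriods.meromorphic_weierstrassP
      fun_prop
    · have hu0 := squarePeriods.analyticAt_inv_weierstrassP.continuousAt.tendsto
      rw [PeriodPair.weierstrassP_zero, inv_zero] at hu0
      filter_upwards [key.filter_mono nhdsWithin_le_nhds,
        (hu0.eventually hnum).filter_mono nhdsWithin_le_nhds,
        squarePeriods.eventually_weierstrassP_ne_zero] with z h1 h2 h3
      rw [← inv_inv (℘[squarePeriods] (α * z)), h1, inv_div]
      generalize ℘[squarePeriods] z = x at *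
      have h4 : α * x ^ 2 - k ≠ 0 := by
        intro h
        refine h2 ?_
        field_simp
        simpa using h
      -- `5 = α(2 - α)` is the norm of `α = 1 + 2i`, whose conjugate is `2 - α`
      have h5 : 5 * x ^ 2 - (2 - α) * k = (2 - α) * (α * x ^ 2 - k) := by
        linear_combination x ^ 2 * hα2
      rw [h5]
      field_simp
      ring
  · exact AnalyticAt.fun_div (by fun_prop) (by fun_prop) (by norm_num)
  · filter_upwards [self_mem_nhdsWithin, hden.filter_mono nhdsWithin_le_nhds,
      hnum.filter_mono nhdsWithin_le_nhds] with t h1 h2 h3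
    exact div_ne_zero (mul_ne_zero h1 (pow_ne_zero _ h3)) (pow_ne_zero _ h2)
  · filter_upwards [hden] with t ht
    have h1 : HasDerivAt (fun t : ℂ ↦ t * (α - k * t ^ 2) ^ 2)
        ((α - k * t ^ 2) ^ 2 + t * (2 * (α - k * t ^ 2) * (-(k * (2 * t))))) t := by
      simpa using (hasDerivAt_id' t).fun_mul
        ((((hasDerivAt_pow 2 t).const_mul k).const_sub α).fun_pow 2)
    have h2 : HasDerivAt (fun t : ℂ ↦ (1 - α * k * t ^ 2) ^ 2)
        (2 * (1 - α * k * t ^ 2) * (-(α * k * (2 * t)))) t := by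
      simpa using (((hasDerivAt_pow 2 t).const_mul (α * k)).const_sub 1).fun_pow 2
    rw [(h1.fun_div h2 (pow_ne_zero _ ht)).deriv]
    simp only [PeriodPair.eval_invCubic, squarePeriods_g₃, hg₂]
    field_simp
    -- the differential equation for `ρ`, in terms of `s = kt²`
    have hpoly (s : ℂ) : (α + (3 * α ^ 2 - 5) * s + α * s ^ 2) ^ 2 * (1 - s)
        = α ^ 2 * ((1 - α * s) ^ 4 - s * (α - s) ^ 4) := by
      linear_combination (α ^ 2 - 1) * s * (1 - s) *
        ((α ^ 2 + 2 * α) * (1 + s + s ^ 2) - (4 * α + 5) * s) * hα2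
    linear_combination 4 * t * (α - k * t ^ 2) ^ 2 * (1 - α * k * t ^ 2) ^ 2 * hpoly (k * t ^ 2)

theorem weierstrassP_hexagonal_identity {z : ℂ}
    (hz : (1 + 2 * cubeRoot) * z ∉ hexagonalPeriods.lattice) :
    3 * ℘[hexagonalPeriods] z ^ 2 ≠ 0 ∧ ℘[hexagonalPeriods] ((1 + 2 * cubeRoot) * z) =
      (4 * ℘[hexagonalPeriods] (1 / 2) ^ 3 - ℘[hexagonalPeriods] z ^ 3)
        / (3 * ℘[hexagonalPeriods] z ^ 2) := by
  have h := weierstrassP_hexagonal_mul hz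
  have h0 : 3 * ℘[hexagonalPeriods] z ^ 2 ≠ 0 := by
    intro h0
    have hx : ℘[hexagonalPeriods] z = 0 := by simpa using h0
    rw [hx] at h
    exact weierstrassP_half_hexagonal_ne_zero (by simpa using h)
  exact ⟨h0, by rw [eq_div_iff h0]; linear_combination h⟩

theorem weierstrassP_square_identity {z : ℂ}
    (hz : (1 + 2 * Complex.I) * z ∉ squarePeriods.lattice) :
    (5 * ℘[squarePeriods] z ^ 2
          - (1 - 2 * Complex.I) * ℘[squarePeriods] (Complex.I / 2) ^ 2) ^ 2 ≠ 0 ∧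
      ℘[squarePeriods] ((1 + 2 * Complex.I) * z) =
        (-1 + 2 * Complex.I) ^ 2 *
          (℘[squarePeriods] z * (℘[squarePeriods] z ^ 2
              - (1 + 2 * Complex.I) * ℘[squarePeriods] (Complex.I / 2) ^ 2) ^ 2
            / (5 * ℘[squarePeriods] z ^ 2
              - (1 - 2 * Complex.I) * ℘[squarePeriods] (Complex.I / 2) ^ 2) ^ 2) := by
  have h := weierstrassP_square_mul hz
  have hk := pow_ne_zero 2 weierstrassP_half_I_ne_zero
  generalize ℘[squarePeriods] (Complex.I / 2) ^ 2 = k at *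
  generalize ℘[squarePeriods] z = x at *
  have h0 : (5 * x ^ 2 - (1 - 2 * Complex.I) * k) ^ 2 ≠ 0 := by
    -- numerator and denominator have no common zero, as `k ≠ 0`
    intro h0
    rw [h0, mul_zero, zero_sub, neg_eq_zero] at h
    have h1 := pow_eq_zero_iff two_ne_zero |>.1 h0
    have hβ : (-1 + 2 * Complex.I) ≠ 0 := fun h ↦ by simpa using congrArg Complex.re h
    rcases mul_eq_zero.1 ((mul_eq_zero.1 h).resolve_left (pow_ne_zero 2 hβ)) with h2 | h2
    · have : (1 - 2 * Complex.I) * k = 0 := by rw [h2] at h1; linear_combination -h1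
      exact (mul_ne_zero (fun h ↦ by simpa using congrArg Complex.re h) hk) this
    · have h3 := pow_eq_zero_iff two_ne_zero |>.1 h2
      have : (4 + 12 * Complex.I) * k = 0 := by linear_combination h1 - 5 * h3
      exact (mul_ne_zero (fun h ↦ by simpa using congrArg Complex.re h) hk) this
  refine ⟨h0, ?_⟩
  rw [← mul_div_assoc, eq_div_iff h0]
  linear_combination h

end

/-! ### Automorphisms of short Weierstrass curves and the two endomorphisms -/

noncomputable section

namespace WeierstrassCurve.Affine

variable {F : Type*} [Field F] {W : WeierstrassCurve.Affine F}

/-- `W` has a short Weierstrass equation `y² = x³ + a₄x + a₆`, which is preserved by the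
substitution `(x, y) ↦ (u²x, u³y)`. -/
structure ScaleInvariant (W : WeierstrassCurve.Affine F) (u : F) : Prop where
  a₁ : W.a₁ = 0
  a₂ : W.a₂ = 0
  a₃ : W.a₃ = 0
  ne_zero : u ≠ 0
  a₄ : u ^ 4 * W.a₄ = W.a₄
  a₆ : u ^ 6 * W.a₆ = W.a₆

namespace ScaleInvariant

variable {u : F}

theorem negY_eq (hu : ScaleInvariant W u) (x y : F) : W.negY x y = -y := by
  simp [negY, hu.a₁, hu.a₃]

theorem slope_scale [DecidableEq F] (hu : ScaleInvariant W u) (x₁ x₂ y₁ y₂ : F) :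
    W.slope (u ^ 2 * x₁) (u ^ 2 * x₂) (u ^ 3 * y₁) (u ^ 3 * y₂) = u * W.slope x₁ x₂ y₁ y₂ := by
  have h0 := hu.ne_zero
  have hx : u ^ 2 * x₁ = u ^ 2 * x₂ ↔ x₁ = x₂ := mul_right_inj' (pow_ne_zero 2 h0)
  have hy : u ^ 3 * y₁ = -(u ^ 3 * y₂) ↔ y₁ = -y₂ := by
    rw [← mul_neg]
    exact mul_right_inj' (pow_ne_zero 3 h0)
  simp only [slope, hu.negY_eq, hx, hy]
  split_ifs with h1 h2
  · simp
  · simp only [hu.a₁, hu.a₂, sub_neg_eq_add, ← mul_add]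
    rw [← mul_div_assoc, mul_div_assoc, ← mul_div_mul_left _ (y₁ + y₁) (pow_ne_zero 3 h0),
      ← mul_div_assoc]
    congr 1
    linear_combination -hu.a₄
  · rw [← mul_sub, ← mul_sub, ← mul_div_mul_left (y₁ - y₂) (x₁ - x₂) (pow_ne_zero 2 h0),
      ← mul_div_assoc]
    congr 1
    ring

theorem nonsingular_scale (hu : ScaleInvariant W u) {x y : F} (h : W.Nonsingular x y) :
    W.Nonsingular (u ^ 2 * x) (u ^ 3 * y) := by
  rw [nonsingular_iff', equation_iff] at *
  simp only [hu.a₁, hu.a₂, hu.a₃] at *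
  refine ⟨by linear_combination u ^ 6 * h.1 + x * u ^ 2 * hu.a₄ + hu.a₆, ?_⟩
  refine h.2.imp (fun h1 h2 ↦ h1 ?_) fun h1 h2 ↦ h1 ?_
  · refine (mul_right_inj' (pow_ne_zero 4 hu.ne_zero)).1 ?_
    linear_combination h2 - hu.a₄
  · refine (mul_right_inj' (pow_ne_zero 3 hu.ne_zero)).1 ?_
    linear_combination h2

/-- The automorphism `(x, y) ↦ (u²x, u³y)` of the group of points. -/
def pointHom [DecidableEq F] (hu : ScaleInvariant W u) : W.Point →+ W.Point where
  toFun P := match P with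
    | 0 => 0
    | .some _ _ h => .some _ _ (hu.nonsingular_scale h)
  map_zero' := rfl
  map_add' := by
    have h0 := hu.ne_zero
    rintro (_ | ⟨x₁, y₁, h₁⟩) (_ | ⟨x₂, y₂, h₂⟩)
    any_goals rfl
    by_cases hxy : x₁ = x₂ ∧ y₁ = W.negY x₂ y₂
    · rw [Point.add_of_Y_eq hxy.1 hxy.2]
      refine (Point.add_of_Y_eq ?_ ?_).symm
      · rw [hxy.1]
      · rw [hxy.2, hu.negY_eq, hu.negY_eq, mul_neg]
    · have hxy' : ¬ (u ^ 2 * x₁ = u ^ 2 * x₂ ∧ u ^ 3 * y₁ = W.negY (u ^ 2 * x₂) (u ^ 3 * y₂)) := by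
        refine fun h ↦ hxy ⟨(mul_right_inj' (pow_ne_zero 2 h0)).1 h.1,
          (mul_right_inj' (pow_ne_zero 3 h0)).1 ?_⟩
        rw [h.2, hu.negY_eq, hu.negY_eq, mul_neg]
      rw [Point.add_some hxy]
      refine Eq.trans ?_ (Point.add_some hxy').symm
      simp only [Point.some.injEq, addX, addY, negAddY, hu.negY_eq, hu.slope_scale, hu.a₁, hu.a₂]
      constructor <;> ring

theorem exists_pointHom_some [DecidableEq F] (hu : ScaleInvariant W u) {x y x' y' : F}
    (h : W.Nonsingular x y) (hx : x' = u ^ 2 * x) (hy : y' = u ^ 3 * y) :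
    ∃ h', hu.pointHom (.some x y h) = .some x' y' h' := by
  subst hx hy
  exact ⟨hu.nonsingular_scale h, rfl⟩

theorem exists_neg_some (hu : ScaleInvariant W u) {x y y' : F} (h : W.Nonsingular x y)
    (hy : y' = -y) : ∃ h', (-.some x y h : W.Point) = .some x y' h' := by
  subst hy
  have h' := (W.nonsingular_neg x y).2 h
  rw [hu.negY_eq] at h'
  refine ⟨h', ?_⟩
  rw [Point.neg_some]
  simp only [hu.negY_eq]

/-- Addition of two points with distinct abscissas, in terms of the slope `ℓ` of the chord. -/
theorem exists_some_add_some [DecidableEq F] (hu : ScaleInvariant W u) {x₁ y₁ x₂ y₂ x₃ y₃ ℓ : F}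
    (h₁ : W.Nonsingular x₁ y₁) (h₂ : W.Nonsingular x₂ y₂) (hx : x₁ ≠ x₂)
    (hℓ : ℓ * (x₁ - x₂) = y₁ - y₂) (hx₃ : x₃ = ℓ ^ 2 - x₁ - x₂) (hy₃ : y₃ = ℓ * (x₁ - x₃) - y₁) :
    ∃ h₃, (.some x₁ y₁ h₁ + .some x₂ y₂ h₂ : W.Point) = .some x₃ y₃ h₃ := by
  have hs : W.slope x₁ x₂ y₁ y₂ = ℓ := by
    rw [slope_of_X_ne hx, ← hℓ, mul_div_cancel_right₀ _ (sub_ne_zero.2 hx)]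
  have hX : W.addX x₁ x₂ ℓ = x₃ := by
    simp [addX, hu.a₁, hu.a₂, hx₃]
  have hY : W.addY x₁ x₂ y₁ ℓ = y₃ := by
    rw [addY, negAddY, hu.negY_eq, hX, hy₃]
    ring
  have h := nonsingular_add h₁ h₂ fun hxy ↦ hx hxy.1
  rw [hs, hX, hY] at h
  refine ⟨h, ?_⟩
  rw [Point.add_of_X_ne hx]
  simp only [hs, hX, hY]

end ScaleInvariant

end WeierstrassCurve.Affine

open WeierstrassCurve.Affine

theorem one_add_two_mul_cubeRoot : 1 + 2 * cubeRoot = Complex.I * (Real.sqrt 3 : ℂ) := by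
  have h : (2 * Real.pi * Complex.I / 3 : ℂ) = ((Real.pi - Real.pi / 3 : ℝ) : ℂ) * Complex.I := by
    push_cast
    ring
  rw [cubeRoot, h, Complex.exp_mul_I, ← Complex.ofReal_cos, ← Complex.ofReal_sin,
    Real.cos_pi_sub, Real.sin_pi_sub, Real.cos_pi_div_three, Real.sin_pi_div_three]
  push_cast
  ring

/-- `[ω]`, that is `(x, y) ↦ (ωx, y)`, is the substitution given by `u = ω²`. -/
theorem hexagonalCurve_scaleInvariant : ScaleInvariant hexagonalCurve (cubeRoot ^ 2) where
  a₁ := rfl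
  a₂ := rfl
  a₃ := rfl
  ne_zero := pow_ne_zero _ cubeRoot_ne_zero
  a₄ := by simp [hexagonalCurve]
  a₆ := by
    simp only [hexagonalCurve]
    linear_combination (-(cubeRoot ^ 9 + cubeRoot ^ 6 + cubeRoot ^ 3 + 1)) * cubeRoot_pow_three

/-- `[i]`, that is `(x, y) ↦ (-x, iy)`, is the substitution given by `u = -i`. -/
theorem squareCurve_scaleInvariant : ScaleInvariant squareCurve (-Complex.I) where
  a₁ := rfl
  a₂ := rfl
  a₃ := rfl
  ne_zero := by simp
  a₄ := by simp [squareCurve, Even.neg_pow (by decide : Even 4)]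
  a₆ := by simp [squareCurve]

/-- The endomorphism `[ω] - [ω²]` of `y² = x³ - 1`. -/
def hexagonalEnd : hexagonalCurve.Point →+ hexagonalCurve.Point :=
  hexagonalCurve_scaleInvariant.pointHom -
    hexagonalCurve_scaleInvariant.pointHom.comp hexagonalCurve_scaleInvariant.pointHom

/-- The endomorphism `-[1 + 2i]` of `y² = x³ - x`, as `-(([1] + [i]) + [i])`. -/
def squareEnd : squareCurve.Point →+ squareCurve.Point :=
  -(AddMonoidHom.id _ + squareCurve_scaleInvariant.pointHom
    + squareCurve_scaleInvariant.pointHom)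

theorem hexagonalCurve_equation {x y : ℂ} : hexagonalCurve.Equation x y ↔ y ^ 2 = x ^ 3 - 1 := by
  rw [equation_iff]
  simp [hexagonalCurve, sub_eq_add_neg]

theorem squareCurve_equation {x y : ℂ} : squareCurve.Equation x y ↔ y ^ 2 = x ^ 3 - x := by
  rw [equation_iff]
  simp [squareCurve, sub_eq_add_neg]

theorem exists_omega_some {x y : ℂ} (h : hexagonalCurve.Nonsingular x y) :
    ∃ h', hexagonalCurve_scaleInvariant.pointHom (.some x y h) = .some (cubeRoot * x) y h' :=
  hexagonalCurve_scaleInvariant.exists_pointHom_some h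
    (by linear_combination -cubeRoot * x * cubeRoot_pow_three)
    (by linear_combination -(cubeRoot ^ 3 + 1) * y * cubeRoot_pow_three)

theorem exists_I_some {x y : ℂ} (h : squareCurve.Nonsingular x y) :
    ∃ h', squareCurve_scaleInvariant.pointHom (.some x y h) = .some (-x) (Complex.I * y) h' :=
  squareCurve_scaleInvariant.exists_pointHom_some h
    (by linear_combination -x * Complex.I_sq)
    (by linear_combination Complex.I * y * Complex.I_sq)

theorem hexagonalEnd_some {x y : ℂ} (h : hexagonalCurve.Nonsingular x y) :
    (x = 0 → hexagonalEnd (.some x y h) = 0) ∧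
    (x ≠ 0 → ∃ h', hexagonalEnd (.some x y h) =
      .some ((4 - x ^ 3) / (3 * x ^ 2))
        (Complex.I * (Real.sqrt 3 : ℂ) / 9 * ((x ^ 3 + 8) / x ^ 3) * y) h') := by
  have hu := hexagonalCurve_scaleInvariant
  have heq := hexagonalCurve_equation.1 h.1
  have hω := cubeRoot_sq_add_cubeRoot_add_one
  obtain ⟨h₁, e₁⟩ := exists_omega_some h
  obtain ⟨h₂, e₂⟩ := exists_omega_some h₁
  obtain ⟨h₃, e₃⟩ := hu.exists_neg_some h₂ rfl
  have hf : hexagonalEnd (.some x y h) = .some _ _ h₁ + .some _ _ h₃ := by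
    rw [← e₃, ← e₂, ← e₁, ← sub_eq_add_neg]
    rfl
  rw [hf]
  constructor
  · rintro rfl
    exact Point.add_of_Y_eq (by simp) (by rw [hu.negY_eq, neg_neg])
  · intro hx
    rw [← one_add_two_mul_cubeRoot]
    have hs := one_add_two_mul_cubeRoot_sq
    have hs0 : 1 + 2 * cubeRoot ≠ 0 := by
      intro h
      norm_num [h] at hs
    refine hu.exists_some_add_some (ℓ := -2 * (1 + 2 * cubeRoot) * y / (3 * x)) h₁ h₃ ?_ ?_ ?_ ?_
    · intro h
      have h1 : (1 + 2 * cubeRoot) * x = 0 := by linear_combination h + x * hω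
      exact mul_ne_zero hs0 hx h1
    · field_simp
      linear_combination (4 * cubeRoot - 6) * y * hω
    · field_simp
      linear_combination (9 * x ^ 3 - 16 * y ^ 2) * hω + 12 * heq
    · field_simp
      linear_combination 108 * x ^ 3 * y * hω

theorem squareEnd_some {x y : ℂ} (h : squareCurve.Nonsingular x y) :
    (5 * x ^ 2 - (1 - 2 * Complex.I) = 0 → squareEnd (.some x y h) = 0) ∧
    (5 * x ^ 2 - (1 - 2 * Complex.I) ≠ 0 → ∃ h', squareEnd (.some x y h) =
      .some
        ((-1 + 2 * Complex.I) ^ 2 * x * (x ^ 2 - (1 + 2 * Complex.I)) ^ 2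
          / (5 * x ^ 2 - (1 - 2 * Complex.I)) ^ 2)
        ((-1 + 2 * Complex.I) ^ 3 * (x ^ 2 - (1 + 2 * Complex.I))
            * (x ^ 4 + (8 * Complex.I + 2) * x ^ 2 + 1)
          / (5 * x ^ 2 - (1 - 2 * Complex.I)) ^ 3 * y) h') := by
  have hu := squareCurve_scaleInvariant
  have heq := squareCurve_equation.1 h.1
  have hI := Complex.I_sq
  obtain ⟨h₁, e₁⟩ := exists_I_some h
  have hf : squareEnd (.some x y h) = -((.some x y h + .some _ _ h₁) + .some _ _ h₁) := by
    rw [← e₁]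
    rfl
  rw [hf]
  rcases eq_or_ne x 0 with rfl | hx
  · have hy : y = 0 := by simpa using heq
    subst hy
    rw [Point.add_of_Y_eq (by simp) (by rw [hu.negY_eq]; simp), zero_add]
    obtain ⟨h₂, e₂⟩ := hu.exists_neg_some h₁ rfl
    refine ⟨fun h0 ↦ ?_, fun _ ↦ ?_⟩
    · simpa using congrArg Complex.re h0
    · rw [e₂]
      simpa using h
  · obtain ⟨h₂, e₂⟩ := hu.exists_some_add_some (x₃ := -Complex.I * (x ^ 2 - 1) / (2 * x))
      (y₃ := -(1 + Complex.I) * (x ^ 2 + 1) * y / (4 * x ^ 2))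
      (ℓ := (1 - Complex.I) * y / (2 * x)) h h₁ (by simpa [self_eq_neg] using hx)
      (by field_simp; ring)
      (by field_simp; linear_combination 2 * Complex.I * heq - y ^ 2 * hI)
      (by field_simp; linear_combination (4 * x ^ 2 * y - 4 * y) * hI)
    constructor
    · intro h0
      -- `P + [i]P` has the abscissa of `[i]P` and is not `[i]P`, so it is `-[i]P`
      rw [neg_eq_zero]
      have hX : -Complex.I * (x ^ 2 - 1) / (2 * x) = -x := by
        field_simp
        linear_combination (2 - Complex.I) / 5 * h0 + 2 / 5 * hI
      rcases (Point.X_eq_iff (h₁ := h₂) (h₂ := h₁)).1 hX with h3 | h3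
      · rw [← e₂] at h3
        exact absurd (add_eq_right.1 h3) (Point.some_ne_zero h)
      · rw [e₂, h3, neg_add_cancel]
    · intro h0
      rw [e₂]
      obtain ⟨D, hD⟩ : ∃ D, D = 5 * x ^ 2 - (1 - 2 * Complex.I) := ⟨_, rfl⟩
      rw [← hD] at h0 ⊢
      have hX : -Complex.I * (x ^ 2 - 1) / (2 * x) - -x = (2 - Complex.I) * D / (10 * x) := by
        field_simp
        linear_combination (-2 * (2 - Complex.I)) * hD + 4 * hI
      have hI2 : (2 - Complex.I : ℂ) ≠ 0 := fun h ↦ by simpa using congrArg Complex.re h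
      have hX' : -Complex.I * (x ^ 2 - 1) / (2 * x) ≠ -x := by
        rw [ne_eq, ← sub_eq_zero, hX]
        exact div_ne_zero (mul_ne_zero hI2 h0) (mul_ne_zero (by norm_num) hx)
      -- the chord through `P + [i]P` and `[i]P` has slope `-Ny/(2xD)`
      obtain ⟨N, hN⟩ : ∃ N, N = (-3 + 11 * Complex.I) * x ^ 2 + (1 + 3 * Complex.I) := ⟨_, rfl⟩
      -- with denominators cleared: the slope, then the abscissa and the ordinate of the sum
      have p₁ : (2 - Complex.I) * N = (5 + 25 * Complex.I) * x ^ 2 + 5 + 5 * Complex.I := by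
        rw [hN]
        linear_combination (-3 - 11 * x ^ 2) * hI
      have p₂ : 4 * x ^ 2 * ((-1 + 2 * Complex.I) ^ 2 * (x ^ 2 - (1 + 2 * Complex.I)) ^ 2) =
          (x ^ 2 - 1) * N ^ 2 + D ^ 2 * (2 * Complex.I * (x ^ 2 - 1) + 4 * x ^ 2) := by
        rw [hN, hD]
        linear_combination (1 + 8 * Complex.I
          + (-7 - 8 * Complex.I + 64 * Complex.I ^ 2) * x ^ 2
          + (47 - 64 * Complex.I) * x ^ 4 - 105 * x ^ 6) * hI
      have p₃ : -4 * x ^ 2 * ((-1 + 2 * Complex.I) ^ 3 * (x ^ 2 - (1 + 2 * Complex.I))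
            * (x ^ 4 + (8 * Complex.I + 2) * x ^ 2 + 1)) =
          N * (Complex.I * (x ^ 2 - 1) * D ^ 2 + 2 * x ^ 2 * ((-1 + 2 * Complex.I) ^ 2
            * (x ^ 2 - (1 + 2 * Complex.I)) ^ 2)) + (1 + Complex.I) * (x ^ 2 + 1) * D ^ 3 := by
        rw [hN, hD]
        linear_combination (1 - 4 * Complex.I + 4 * Complex.I ^ 2
          + (-20 + 36 * Complex.I + 56 * Complex.I ^ 2 - 96 * Complex.I ^ 3) * x ^ 2
          + (66 - 4 * Complex.I - 236 * Complex.I ^ 2 + 160 * Complex.I ^ 3) * x ^ 4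
          + (-60 - 260 * Complex.I + 160 * Complex.I ^ 2) * x ^ 6
          + (-115 - 120 * Complex.I) * x ^ 8) * hI
      rw [mul_assoc _ x, mul_left_comm _ x]
      generalize (-1 + 2 * Complex.I) ^ 2 * (x ^ 2 - (1 + 2 * Complex.I)) ^ 2 = A at p₂ p₃ ⊢
      generalize (-1 + 2 * Complex.I) ^ 3 * (x ^ 2 - (1 + 2 * Complex.I))
            * (x ^ 4 + (8 * Complex.I + 2) * x ^ 2 + 1) = B at p₃ ⊢
      obtain ⟨h₃, e₃⟩ := hu.exists_some_add_some
        (x₃ := x * A / D ^ 2) (y₃ := -(B / D ^ 3 * y)) (ℓ := -N * y / (2 * x * D)) h₂ h₁ hX'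
        (by rw [hX]; field_simp; linear_combination (-4 * y) * p₁)
        (by field_simp; linear_combination x * p₂ - N ^ 2 * heq)
        (by field_simp; linear_combination 4 * y * p₃)
      rw [e₃]
      exact hu.exists_neg_some h₃ (neg_neg _).symm

end

/-! ### Isogenies given by formulas, and their degrees -/

noncomputable section

namespace EllipticIsogeny

open WeierstrassCurve WeierstrassCurve.Affine Polynomial IntermediateField
open scoped Polynomial.Bivariate

variable {W : WeierstrassCurve.Affine ℂ}

theorem toFunctionField_C (p : ℂ[X]) : toFunctionField W (C p) = aeval (xFun W) p := by
  have h : (algebraMap W.CoordinateRing W.FunctionField).comp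
      ((CoordinateRing.mk W).comp C) = (aeval (xFun W) : ℂ[X] →ₐ[ℂ] W.FunctionField) := by
    refine Polynomial.ringHom_ext (fun a ↦ ?_) ?_
    · simp only [RingHom.comp_apply, RingHom.coe_coe, aeval_C]
      rw [IsScalarTower.algebraMap_apply ℂ W.CoordinateRing W.FunctionField]
      rfl
    · simp [xFun, toFunctionField]
  exact congr($h p)

theorem toFunctionField_X : toFunctionField W X = yFun W := rfl

theorem toFunctionField_mul (p q : ℂ[X][Y]) :
    toFunctionField W (p * q) = toFunctionField W p * toFunctionField W q := by
  simp [toFunctionField]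

theorem aeval_xFun_injective : Function.Injective (aeval (R := ℂ) (xFun W)) := by
  intro p q h
  rw [← toFunctionField_C, ← toFunctionField_C] at h
  exact FaithfulSMul.algebraMap_injective ℂ[X] W.CoordinateRing
    (IsFractionRing.injective W.CoordinateRing W.FunctionField h)

/-- The homomorphism `ℂ[W] → ℂ(W')` that sends the coordinates to a point of `W` over `ℂ(W')`. -/
def coordinateHom (W' : WeierstrassCurve.Affine ℂ) (x y : W'.FunctionField)
    (h : W.polynomial.eval₂ (aeval x : ℂ[X] →ₐ[ℂ] W'.FunctionField) y = 0) :
    W.CoordinateRing →ₐ[ℂ] W'.FunctionField :=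
  AdjoinRoot.liftAlgHom W.polynomial (aeval x) y h

/-- `ℂ[W]` is integral over `ℂ[X]`, so a nonzero kernel would contain a nonzero polynomial in `X`,
and `x` would be algebraic. -/
theorem coordinateHom_injective {W' : WeierstrassCurve.Affine ℂ} {x y : W'.FunctionField}
    (h : W.polynomial.eval₂ (aeval x : ℂ[X] →ₐ[ℂ] W'.FunctionField) y = 0)
    (hx : Transcendental ℂ x) : Function.Injective (coordinateHom W' x y h) := by
  have hint : Algebra.IsIntegral ℂ[X] W.CoordinateRing :=
    have : Module.Finite ℂ[X] W.CoordinateRing := (monic_polynomial (W := W)).finite_adjoinRoot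
    Algebra.IsIntegral.of_finite _ _
  rw [← AlgHom.coe_toRingHom, RingHom.injective_iff_ker_eq_bot]
  refine Ideal.eq_bot_of_comap_eq_bot (R := ℂ[X]) ?_
  rw [eq_bot_iff]
  intro p hp
  rw [Ideal.mem_comap, RingHom.mem_ker] at hp
  have : aeval x p = 0 := by
    rw [← hp]
    exact (AdjoinRoot.lift_of (i := (aeval x : ℂ[X] →ₐ[ℂ] W'.FunctionField).toRingHom) h).symm
  exact transcendental_iff.1 hx p this

/-- A point of a Weierstrass curve `W` (with `a₁ = a₃ = 0`) over `ℂ(W')` whose abscissa is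
not constant defines an embedding `ℂ(W) → ℂ(W')`. -/
theorem exists_algHom_functionField (W' : WeierstrassCurve.Affine ℂ) (h₁ : W.a₁ = 0)
    (h₃ : W.a₃ = 0)
    {x y : W'.FunctionField} (hx : Transcendental ℂ x)
    (h : y ^ 2 = aeval x (X ^ 3 + C W.a₂ * X ^ 2 + C W.a₄ * X + C W.a₆)) :
    ∃ φ : W.FunctionField →ₐ[ℂ] W'.FunctionField, φ (xFun W) = x ∧ φ (yFun W) = y := by
  have h' : W.polynomial.eval₂ (aeval x : ℂ[X] →ₐ[ℂ] W'.FunctionField) y = 0 := by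
    simp only [WeierstrassCurve.Affine.polynomial, h₁, h₃, eval₂_sub, eval₂_add, eval₂_mul,
      eval₂_pow, eval₂_X, eval₂_C, RingHom.coe_coe, h]
    simp
  refine ⟨IsFractionRing.liftAlgHom (coordinateHom_injective h' hx), ?_, ?_⟩
  · refine (IsFractionRing.lift_algebraMap (coordinateHom_injective h' hx) _).trans ?_
    refine (AdjoinRoot.lift_mk
      (i := (aeval x : ℂ[X] →ₐ[ℂ] W'.FunctionField).toRingHom) h' _).trans ?_
    simp
  · refine (IsFractionRing.lift_algebraMap (coordinateHom_injective h' hx) _).trans ?_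
    refine (AdjoinRoot.lift_mk
      (i := (aeval x : ℂ[X] →ₐ[ℂ] W'.FunctionField).toRingHom) h' _).trans ?_
    simp

theorem yFun_sq (h₁ : W.a₁ = 0) (h₃ : W.a₃ = 0) :
    yFun W ^ 2 = aeval (xFun W) (X ^ 3 + C W.a₂ * X ^ 2 + C W.a₄ * X + C W.a₆) := by
  rw [← toFunctionField_C, yFun, toFunctionField, toFunctionField, ← map_pow, ← map_pow]
  congr 1
  rw [AdjoinRoot.mk_eq_mk]
  exact ⟨1, by simp [WeierstrassCurve.Affine.polynomial, h₁, h₃]⟩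

theorem aeval_mem_of_mem {E : IntermediateField ℂ W.FunctionField} (p : ℂ[X])
    {x : W.FunctionField} (hx : x ∈ E) : aeval x p ∈ E :=
  adjoin_simple_le_iff.2 hx (algebra_adjoin_le_adjoin _ _ (aeval_mem_adjoin_singleton ℂ x))

theorem adjoin_xFun_yFun : ℂ⟮xFun W, yFun W⟯ = ⊤ := by
  rw [eq_top_iff]
  rintro z -
  have key (a : W.CoordinateRing) :
      algebraMap W.CoordinateRing W.FunctionField a ∈ ℂ⟮xFun W, yFun W⟯ := by
    obtain ⟨p, q, rfl⟩ := CoordinateRing.exists_smul_basis_eq a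
    have hx : xFun W ∈ ℂ⟮xFun W, yFun W⟯ := subset_adjoin _ _ (by simp)
    have hy : yFun W ∈ ℂ⟮xFun W, yFun W⟯ := subset_adjoin _ _ (by simp)
    have hp (p : ℂ[X]) : aeval (xFun W) p ∈ ℂ⟮xFun W, yFun W⟯ :=
      aeval_mem_of_mem _ hx
    have : algebraMap W.CoordinateRing W.FunctionField (p • 1 + q • CoordinateRing.mk W X)
        = aeval (xFun W) p + aeval (xFun W) q * yFun W := by
      rw [CoordinateRing.smul, CoordinateRing.smul, ← toFunctionField_C, ← toFunctionField_C]
      simp [toFunctionField, yFun]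
    rw [this]
    exact add_mem (hp p) (mul_mem (hp q) hy)
  obtain ⟨a, b, -, rfl⟩ := IsFractionRing.div_surjective (A := W.CoordinateRing) z
  exact div_mem (key a) (key b)

theorem finiteDimensional_adjoin_xFun (h₁ : W.a₁ = 0) (h₃ : W.a₃ = 0) :
    FiniteDimensional ℂ⟮xFun W⟯ W.FunctionField := by
  have hint : IsIntegral ℂ⟮xFun W⟯ (yFun W) := by
    refine IsIntegral.of_pow two_pos ?_
    have hmem : yFun W ^ 2 ∈ ℂ⟮xFun W⟯ := by
      rw [yFun_sq h₁ h₃]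
      exact aeval_mem_of_mem _ (mem_adjoin_simple_self ℂ (xFun W))
    exact isIntegral_algebraMap (x := (⟨_, hmem⟩ : ℂ⟮xFun W⟯))
  have htop : ℂ⟮xFun W⟯⟮yFun W⟯ = ⊤ := by
    rw [← restrictScalars_eq_top_iff (K := ℂ), adjoin_simple_adjoin_simple, adjoin_xFun_yFun]
  have := adjoin.finiteDimensional hint
  rw [htop] at this
  exact Module.Finite.equiv (topEquiv (F := ℂ⟮xFun W⟯) (E := W.FunctionField)).toLinearEquiv

theorem max_natDegree_num_denom {p q : ℂ[X]} (hq : q ≠ 0) (hpq : IsCoprime p q) :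
    max (algebraMap ℂ[X] (RatFunc ℂ) p / algebraMap ℂ[X] (RatFunc ℂ) q).num.natDegree
      (algebraMap ℂ[X] (RatFunc ℂ) p / algebraMap ℂ[X] (RatFunc ℂ) q).denom.natDegree =
      max p.natDegree q.natDegree := by
  set r := algebraMap ℂ[X] (RatFunc ℂ) p / algebraMap ℂ[X] (RatFunc ℂ) q with hr
  have h := (RatFunc.num_mul_eq_mul_denom_iff (x := r) hq).2 hr
  have hd : Associated r.denom q := by
    refine associated_of_dvd_dvd (RatFunc.denom_div_dvd p q) ?_
    exact hpq.symm.dvd_of_dvd_mul_left (h ▸ dvd_mul_left q r.num)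
  have hn : Associated r.num p := by
    refine associated_of_dvd_dvd (RatFunc.num_div_dvd p hq) ?_
    exact hpq.dvd_of_dvd_mul_right (h ▸ dvd_mul_right p r.denom)
  rw [natDegree_eq_of_degree_eq (degree_eq_degree_of_associated hn),
    natDegree_eq_of_degree_eq (degree_eq_degree_of_associated hd)]

/-- The embedding `ℂ(X) → ℂ(W)` that sends `X` to the coordinate function `x`. -/
def ratFuncHom (W : WeierstrassCurve.Affine ℂ) : RatFunc ℂ →ₐ[ℂ] W.FunctionField :=
  RatFunc.liftAlgHom (aeval (xFun W))
    (nonZeroDivisors_le_comap_nonZeroDivisors_of_injective _ aeval_xFun_injective)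

theorem ratFuncHom_algebraMap (f : ℂ[X]) :
    ratFuncHom W (algebraMap ℂ[X] (RatFunc ℂ) f) = aeval (xFun W) f := by
  simpa [ratFuncHom] using RatFunc.liftAlgHom_apply_div (aeval (xFun W))
    (nonZeroDivisors_le_comap_nonZeroDivisors_of_injective _ aeval_xFun_injective) f 1

theorem transcendental_aeval_div {p q : ℂ[X]} (hq : q ≠ 0) (hpq : IsCoprime p q)
    (hdeg : 0 < max p.natDegree q.natDegree) :
    Transcendental ℂ (aeval (xFun W) p / aeval (xFun W) q) := by
  have h : Transcendental ℂ (algebraMap ℂ[X] (RatFunc ℂ) p / algebraMap ℂ[X] (RatFunc ℂ) q) := by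
    refine RatFunc.transcendental_of_ne_C _ ?_
    rintro ⟨c, hc⟩
    rw [← max_natDegree_num_denom hq hpq, hc] at hdeg
    simp at hdeg
  rw [← ratFuncHom_algebraMap, ← ratFuncHom_algebraMap, ← map_div₀]
  exact fun hA ↦ h ((isAlgebraic_algHom_iff (ratFuncHom W) (ratFuncHom W).injective).1 hA)

/-- If the pullback sends `x` to a rational function `p/q` of `x` in lowest terms, the degree of the
isogeny is that of `p/q`: in the square of fields `ℂ(φ*x) ⊆ ℂ(x) ⊆ ℂ(W)` and
`ℂ(φ*x) ⊆ φ*ℂ(W) ⊆ ℂ(W)` the extensions `ℂ(W)/ℂ(x)` and `φ*ℂ(W)/ℂ(φ*x)` have the same degree. -/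
theorem isogenyDegree_eq_max_natDegree (h₁ : W.a₁ = 0) (h₃ : W.a₃ = 0)
    (φ : W.FunctionField →ₐ[ℂ] W.FunctionField) {p q : ℂ[X]} (hq : q ≠ 0) (hpq : IsCoprime p q)
    (hφ : φ (xFun W) = aeval (xFun W) p / aeval (xFun W) q) :
    isogenyDegree φ = max p.natDegree q.natDegree := by
  have hfin := finiteDimensional_adjoin_xFun h₁ h₃
  set r := algebraMap ℂ[X] (RatFunc ℂ) p / algebraMap ℂ[X] (RatFunc ℂ) q with hr
  have hψX : ratFuncHom W RatFunc.X = xFun W := by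
    rw [← RatFunc.algebraMap_X, ratFuncHom_algebraMap, aeval_X]
  have hψr : ratFuncHom W r = φ (xFun W) := by
    rw [hr, map_div₀, ratFuncHom_algebraMap, ratFuncHom_algebraMap, hφ]
  have hA : (⊤ : IntermediateField ℂ (RatFunc ℂ)).map (ratFuncHom W) = ℂ⟮xFun W⟯ := by
    rw [← RatFunc.adjoin_X, adjoin_map, Set.image_singleton, hψX]
  have hB : ℂ⟮r⟯.map (ratFuncHom W) = ℂ⟮φ (xFun W)⟯ := by
    rw [adjoin_map, Set.image_singleton, hψr]
  have hB' : ℂ⟮xFun W⟯.map φ = ℂ⟮φ (xFun W)⟯ := by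
    rw [adjoin_map, Set.image_singleton]
  have e₁ : relfinrank ℂ⟮φ (xFun W)⟯ ℂ⟮xFun W⟯ = max p.natDegree q.natDegree := by
    rw [← hA, ← hB, relfinrank_map_map, relfinrank_top_right, RatFunc.finrank_eq_max_natDegree,
      max_natDegree_num_denom hq hpq]
  have e₂ : relfinrank ℂ⟮φ (xFun W)⟯ φ.fieldRange
      = Module.finrank ℂ⟮xFun W⟯ W.FunctionField := by
    rw [← hB', AlgHom.fieldRange_eq_map, relfinrank_map_map, relfinrank_top_right]
  have e₃ := relfinrank_mul_finrank_top (F := ℂ) (E := W.FunctionField)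
    (A := ℂ⟮φ (xFun W)⟯) (B := ℂ⟮xFun W⟯)
    (by rw [← hA, ← hB]; exact map_mono (ratFuncHom W) le_top)
  have e₄ := relfinrank_mul_finrank_top (F := ℂ) (E := W.FunctionField)
    (A := ℂ⟮φ (xFun W)⟯) (B := φ.fieldRange)
    (by rw [← hB', AlgHom.fieldRange_eq_map]; exact map_mono φ le_top)
  rw [e₁] at e₃
  rw [e₂, ← e₃, mul_comm] at e₄
  exact Nat.eq_of_mul_eq_mul_right Module.finrank_pos e₄

/-- A homomorphism of groups of points of a curve `y² = x³ + a₂x² + a₄x + a₆` given by rational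
functions `(p(x)/q(x), r(x)/s(x) y)` is an isogeny, whose degree is that of `p/q`. That
these functions satisfy the equation of the curve follows from the values at points. -/
theorem isIsogenyOfDegree_of_formula [WeierstrassCurve.IsElliptic W] (h₁ : W.a₁ = 0)
    (h₃ : W.a₃ = 0) (f : W.Point →+ W.Point) {p q r s : ℂ[X]} (hq : q ≠ 0) (hpq : IsCoprime p q)
    (hdeg : 0 < max p.natDegree q.natDegree) (hs : ∀ t, s.eval t = 0 → q.eval t = 0)
    (hf : ∀ (x y : ℂ) (h : W.Nonsingular x y), (q.eval x = 0 → f (.some x y h) = 0) ∧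
      (q.eval x ≠ 0 → ∃ h', f (.some x y h) =
        .some (p.eval x / q.eval x) (r.eval x / s.eval x * y) h')) :
    IsIsogenyOfDegree f (max p.natDegree q.natDegree) := by
  have hs0 : s ≠ 0 := by
    rintro rfl
    exact hq (Polynomial.funext fun t ↦ by simpa using hs t (by simp))
  -- the equation of the curve at the image point, checked at all `t ∈ ℂ`
  have hE : r ^ 2 * (X ^ 3 + C W.a₂ * X ^ 2 + C W.a₄ * X + C W.a₆) * q ^ 3 =
      s ^ 2 * (p ^ 3 + C W.a₂ * p ^ 2 * q + C W.a₄ * p * q ^ 2 + C W.a₆ * q ^ 3) := by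
    refine mul_left_cancel₀ hq (Polynomial.funext fun t ↦ ?_)
    simp only [eval_mul, eval_pow, eval_add, eval_X, eval_C]
    by_cases ht : q.eval t = 0
    · simp [ht]
    · obtain ⟨y, hy⟩ := IsAlgClosed.exists_pow_nat_eq
        (t ^ 3 + W.a₂ * t ^ 2 + W.a₄ * t + W.a₆) (two_pos)
      have hyW : W.Nonsingular t y := by
        rw [← equation_iff_nonsingular, equation_iff, h₁, h₃]
        linear_combination hy
      obtain ⟨h', -⟩ := (hf t y hyW).2 ht
      have hst : s.eval t ≠ 0 := fun h ↦ ht (hs t h)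
      have h2 := h'.1
      rw [equation_iff, h₁, h₃] at h2
      field_simp at h2
      rw [← hy]
      linear_combination q.eval t * h2
  have hane {g : ℂ[X]} (hg : g ≠ 0) : aeval (xFun W) g ≠ 0 := by
    simpa using aeval_xFun_injective.ne hg
  obtain ⟨φ, hφx, hφy⟩ := exists_algHom_functionField W h₁ h₃
    (transcendental_aeval_div (W := W) hq hpq hdeg)
    (y := aeval (xFun W) r / aeval (xFun W) s * yFun W) (by
      have h2 := congrArg (aeval (xFun W)) hE
      have h3 := hane hq
      have h4 := hane hs0
      rw [mul_pow, yFun_sq h₁ h₃]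
      simp only [map_mul, map_pow, map_add, aeval_X, aeval_C] at h2 ⊢
      field_simp
      linear_combination h2)
  have hne (a b : ℂ) (h : W.Nonsingular a b) : f (.some a b h) = 0 ↔ q.eval a = 0 := by
    refine ⟨fun h0 ↦ ?_, (hf a b h).1⟩
    by_contra hqa
    obtain ⟨h', e⟩ := (hf a b h).2 hqa
    exact Point.some_ne_zero h' (e.symm.trans h0)
  refine ⟨φ, ⟨fun a b h c d h' e ↦ ?_, fun a b h e ↦ ?_⟩,
    isogenyDegree_eq_max_natDegree h₁ h₃ φ hq hpq hφx⟩
  · have hqa : q.eval a ≠ 0 := by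
      rw [ne_eq, ← hne a b h, e]
      exact Point.some_ne_zero h'
    have hsa : s.eval a ≠ 0 := fun h ↦ hqa (hs a h)
    obtain ⟨h'', e'⟩ := (hf a b h).2 hqa
    rw [e, Point.some.injEq] at e'
    refine ⟨⟨C p, C q, by simpa only [evalEval_C] using hqa, ?_, ?_⟩,
      ⟨C r * X, C s, by simpa only [evalEval_C] using hsa, ?_, ?_⟩⟩
    · rw [hφx, toFunctionField_C, toFunctionField_C, div_mul_cancel₀ _ (hane hq)]
    · simp only [evalEval_C]
      rw [e'.1, div_mul_cancel₀ _ hqa]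
    · rw [hφy, toFunctionField_mul, toFunctionField_C, toFunctionField_C, toFunctionField_X,
        mul_right_comm, div_mul_cancel₀ _ (hane hs0)]
    · simp only [evalEval_C, evalEval_mul, evalEval_X]
      rw [e'.2, mul_right_comm, div_mul_cancel₀ _ hsa]
  · have hqa := (hne a b h).1 e
    have hpa : p.eval a ≠ 0 := by
      obtain ⟨u, v, huv⟩ := hpq
      intro hpa
      simpa [hpa, hqa] using congrArg (eval a) huv
    have hp : p ≠ 0 := by
      rintro rfl
      simp at hpa
    refine ⟨C q, C p, by simpa only [evalEval_C] using hpa, ?_,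
      by simp [evalEval_C, hqa]⟩
    rw [hφx, toFunctionField_C, toFunctionField_C, inv_div, div_mul_cancel₀ _ (hane hp)]

end EllipticIsogeny

open Polynomial in
theorem hexagonalEnd_isIsogeny : EllipticIsogeny.IsIsogenyOfDegree hexagonalEnd 3 := by
  have hp : (4 - X ^ 3 : ℂ[X]).natDegree = 3 := by compute_degree!
  have hq : (3 * X ^ 2 : ℂ[X]).natDegree = 2 := by compute_degree!
  have h := EllipticIsogeny.isIsogenyOfDegree_of_formula (W := hexagonalCurve) rfl rfl hexagonalEnd
    (p := 4 - X ^ 3) (q := 3 * X ^ 2) (r := C (Complex.I * (Real.sqrt 3 : ℂ) / 9) * (X ^ 3 + 8))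
    (s := X ^ 3) (by intro h; simp [h] at hq) ?_ (by simp [hp]) (by simp) fun x y hxy ↦ ?_
  · rwa [hp, hq] at h
  · -- `(4 - X³)/4 + (X/12)(3X²) = 1`
    refine ⟨C (1 / 4), C (1 / 12) * X, ?_⟩
    have h4 : (C (1 / 4) * 4 : ℂ[X]) = 1 := by
      rw [show (4 : ℂ[X]) = C 4 from rfl, ← C_mul]
      norm_num
    have h12 : (C (1 / 12) * 3 : ℂ[X]) = C (1 / 4) := by
      rw [show (3 : ℂ[X]) = C 3 from rfl, ← C_mul]
      norm_num
    linear_combination h4 + X ^ 3 * h12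
  · have := hexagonalEnd_some hxy
    simpa [mul_div_assoc] using this

open Polynomial in
theorem squareEnd_isIsogeny : EllipticIsogeny.IsIsogenyOfDegree squareEnd 5 := by
  have hα : ((-1 + 2 * Complex.I) ^ 2 : ℂ) ≠ 0 :=
    pow_ne_zero 2 fun h ↦ by simpa using congrArg Complex.re h
  have hβ : (1 - 2 * Complex.I : ℂ) ≠ 0 := fun h ↦ by simpa using congrArg Complex.re h
  have hγ : (-4 - 12 * Complex.I : ℂ) ≠ 0 := fun h ↦ by simpa using congrArg Complex.re h
  set p : ℂ[X] := C ((-1 + 2 * Complex.I) ^ 2) * X * (X ^ 2 - C (1 + 2 * Complex.I)) ^ 2 with hp'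
  set q : ℂ[X] := (C 5 * X ^ 2 - C (1 - 2 * Complex.I)) ^ 2 with hq'
  have hp : p.natDegree = 5 := by
    rw [hp', mul_assoc, natDegree_C_mul hα, natDegree_X_mul, natDegree_pow,
      natDegree_X_pow_sub_C]
    exact pow_ne_zero 2 (X_pow_sub_C_ne_zero two_pos _)
  have hq : q.natDegree = 4 := by
    have : (C 5 * X ^ 2 - C (1 - 2 * Complex.I)).natDegree = 2 := by compute_degree!
    rw [hq', natDegree_pow, this]
  have hpq : IsCoprime p q := by
    have hC {c : ℂ} (hc : c ≠ 0) : (C c⁻¹ * C c : ℂ[X]) = 1 := by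
      rw [← C_mul, inv_mul_cancel₀ hc, C_1]
    -- `5(X² - (1 + 2i)) - (5X² - (1 - 2i)) = -4 - 12i` is a nonzero constant
    refine .pow_right (.mul_left (.mul_left ?_ ?_) (.pow_left ?_))
    · exact ⟨C ((-1 + 2 * Complex.I) ^ 2)⁻¹, 0, by rw [hC hα, zero_mul, add_zero]⟩
    · exact ⟨C (1 - 2 * Complex.I)⁻¹ * C 5 * X, -C (1 - 2 * Complex.I)⁻¹, by
        linear_combination hC hβ⟩
    · refine ⟨C (-4 - 12 * Complex.I)⁻¹ * C 5, -C (-4 - 12 * Complex.I)⁻¹, ?_⟩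
      have h : (C (-4 - 12 * Complex.I) : ℂ[X]) =
          C (1 - 2 * Complex.I) - C 5 * C (1 + 2 * Complex.I) := by
        rw [← C_mul, ← C_sub]
        congr 1
        ring
      linear_combination hC hγ - C (-4 - 12 * Complex.I)⁻¹ * h
  have h := EllipticIsogeny.isIsogenyOfDegree_of_formula (W := squareCurve) rfl rfl squareEnd
    (p := p) (q := q) (r := C ((-1 + 2 * Complex.I) ^ 3) * (X ^ 2 - C (1 + 2 * Complex.I))
      * (X ^ 4 + C (8 * Complex.I + 2) * X ^ 2 + 1))
    (s := (C 5 * X ^ 2 - C (1 - 2 * Complex.I)) ^ 3) (by intro h; simp [h] at hq) hpq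
    (by simp [hp]) (by simp [hq']) fun x y hxy ↦ ?_
  · rwa [hp, hq] at h
  · have := squareEnd_some hxy
    simpa [hp', hq'] using this

end

/-! ### The isogenies of degrees three and five and the identities for `℘` -/

theorem mainTheorem10 :
    -- the degree three self-isogeny of `y² = x³ - 1`
    (∃ f : hexagonalCurve.Point →+ hexagonalCurve.Point,
      EllipticIsogeny.IsIsogenyOfDegree f 3 ∧
      ∀ (x y : ℂ) (h : hexagonalCurve.Nonsingular x y),
        (x = 0 → f (.some x y h) = 0) ∧
        (x ≠ 0 → ∃ h', f (.some x y h) =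
          .some ((4 - x ^ 3) / (3 * x ^ 2))
            (Complex.I * (Real.sqrt 3 : ℂ) / 9 * ((x ^ 3 + 8) / x ^ 3) * y) h')) ∧
    -- the identity for the Weierstrass function of `ℤ + ℤω`
    (∀ z : ℂ, (1 + 2 * cubeRoot) * z ∉ hexagonalPeriods.lattice →
      3 * (℘[hexagonalPeriods] z - ℘[hexagonalPeriods] (1 / 2)
          + (℘[hexagonalPeriods] (cubeRoot / 2) - ℘[hexagonalPeriods] (1 / 2))
            / (cubeRoot - 1)) ^ 2 ≠ 0 ∧
      ℘[hexagonalPeriods] ((1 + 2 * cubeRoot) * z) - ℘[hexagonalPeriods] (1 / 2)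
          + (℘[hexagonalPeriods] (cubeRoot / 2) - ℘[hexagonalPeriods] (1 / 2)) / (cubeRoot - 1) =
        (4 * ((℘[hexagonalPeriods] (cubeRoot / 2) - ℘[hexagonalPeriods] (1 / 2))
              / (cubeRoot - 1)) ^ 3
          - (℘[hexagonalPeriods] z - ℘[hexagonalPeriods] (1 / 2)
            + (℘[hexagonalPeriods] (cubeRoot / 2) - ℘[hexagonalPeriods] (1 / 2))
              / (cubeRoot - 1)) ^ 3)
        / (3 * (℘[hexagonalPeriods] z - ℘[hexagonalPeriods] (1 / 2)
            + (℘[hexagonalPeriods] (cubeRoot / 2) - ℘[hexagonalPeriods] (1 / 2))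
              / (cubeRoot - 1)) ^ 2)) ∧
    -- the degree five self-isogeny of `y² = x³ - x`
    (∃ f : squareCurve.Point →+ squareCurve.Point,
      EllipticIsogeny.IsIsogenyOfDegree f 5 ∧
      ∀ (x y : ℂ) (h : squareCurve.Nonsingular x y),
        (5 * x ^ 2 - (1 - 2 * Complex.I) = 0 → f (.some x y h) = 0) ∧
        (5 * x ^ 2 - (1 - 2 * Complex.I) ≠ 0 → ∃ h', f (.some x y h) =
          .some
            ((-1 + 2 * Complex.I) ^ 2 * x * (x ^ 2 - (1 + 2 * Complex.I)) ^ 2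
              / (5 * x ^ 2 - (1 - 2 * Complex.I)) ^ 2)
            ((-1 + 2 * Complex.I) ^ 3 * (x ^ 2 - (1 + 2 * Complex.I))
                * (x ^ 4 + (8 * Complex.I + 2) * x ^ 2 + 1)
              / (5 * x ^ 2 - (1 - 2 * Complex.I)) ^ 3 * y) h')) ∧
    -- the identity for the Weierstrass function of `ℤ + ℤi`
    (∀ z : ℂ, (1 + 2 * Complex.I) * z ∉ squarePeriods.lattice →
      (5 * ℘[squarePeriods] z ^ 2
          - (1 - 2 * Complex.I) * ℘[squarePeriods] (Complex.I / 2) ^ 2) ^ 2 ≠ 0 ∧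
      ℘[squarePeriods] ((1 + 2 * Complex.I) * z) =
        (-1 + 2 * Complex.I) ^ 2 *
          (℘[squarePeriods] z * (℘[squarePeriods] z ^ 2
              - (1 + 2 * Complex.I) * ℘[squarePeriods] (Complex.I / 2) ^ 2) ^ 2
            / (5 * ℘[squarePeriods] z ^ 2
              - (1 - 2 * Complex.I) * ℘[squarePeriods] (Complex.I / 2) ^ 2) ^ 2)) := by
  refine ⟨⟨hexagonalEnd, hexagonalEnd_isIsogeny, fun x y h ↦ hexagonalEnd_some h⟩, fun z hz ↦ ?_,
    ⟨squareEnd, squareEnd_isIsogeny, fun x y h ↦ squareEnd_some h⟩,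
    fun z hz ↦ weierstrassP_square_identity hz⟩
  -- `℘(ω/2) = ω℘(1/2)`, so the constant `c` is `℘(1/2)`
  have hc : (℘[hexagonalPeriods] (cubeRoot / 2) - ℘[hexagonalPeriods] (1 / 2)) / (cubeRoot - 1) =
      ℘[hexagonalPeriods] (1 / 2) := by
    rw [show cubeRoot / 2 = cubeRoot * (1 / 2) by ring, weierstrassP_cubeRoot_mul,
      div_eq_iff cubeRoot_sub_one_ne_zero]
    ring
  rw [hc, sub_add_cancel, sub_add_cancel]
  exact weierstrassP_hexagonal_identity hz
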